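/- Let $L,R\ge 0$ (almost surely) and $X_0$ be real random variables, put $\mathcal S(s)=\mathbb E[L^s+R^s]-1\in[-1,\infty]$ for $s>0$, and assume $\mathbb E[L^\alpha+R^\alpha]=1$ and $\mathcal S(\gamma)<0$, where $0<\alpha<\gamma\le 1$ or $1\le\alpha<\gamma\le 2$. Let $F_0$ be the distribution function of $X_0$. If $\alpha\neq1$, assume that the limits $$\lim_{x\to+\infty}x^\alpha(1-F_0(x))=c^+<\infty,\qquad \lim_{x\to-\infty}|x|^\alpha F_0(x)=c^-<\infty$$ exist and are finite (possibly zero); if $\alpha=1$, assume instead $\mathbb E|X_0|^\gamma<\infty$. For $t\ge0$ let $V_t$ be a real random variable whose characteristic function $\phi(t;\cdot)$ solves the kinetic equation $$\partial_t\phi(t;\xi)+\phi(t;\xi)=\mathbb E[\phi(t;L\xi)\,\phi(t;R\xi)]\quad(t>0,\ \xi\in\mathbb R),\qquad \phi(0;\xi)=\mathbb E[e^{i\xi X_0}],$$ where $t\mapsto\phi(t;\xi)$ is continuous at $t=0$ for every $\xi$. Let $V_\infty$ be the limit in distribution of $V_t$ as $t\to\infty$. For $\gamma>0$ let $$\mathcal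 W_\gamma(X,Y)=\inf_{(X',Y')}\big(\mathbb E|X'-Y'|^\gamma\big)^{1/\max(\gamma,1)}\in[0,\infty],$$ the infimum being over all pairs $(X',Y')$ of real random variables such that $X'$ has the law of $X$ and $Y'$ has the law of $Y$. Then, for every $t\ge0$, $$\mathcal W_\gamma(V_t,V_\infty)\le A\,\mathcal W_\gamma(X_0,V_\infty)\,e^{-Bt|\mathcal S(\gamma)|},$$ with $A=B=1$ if $\gamma\le1$, and $A=2^{1/\gamma}$, $B=1/\gamma$ otherwise. (The bound is understood in $[0,\infty]$, and is trivial if $\mathcal W_\gamma(X_0,V_\infty)=\infty$.) -/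

import Mathlib

open MeasureTheory ProbabilityTheory Filter Topology Set
open scoped ENNReal

namespace KineticCLT

section

variable {Ω : Type*} [MeasurableSpace Ω]

/-- The moment `E[L ^ s + R ^ s]` as an extended non-negative number, for (almost surely)
non-negative random variables `L`, `R` and an exponent `s > 0`. -/
noncomputable def powerMoment (P : Measure Ω) (L R : Ω → ℝ) (s : ℝ) : ℝ≥0∞ :=
  ∫⁻ ω, ENNReal.ofReal (L ω ^ s + R ω ^ s) ∂P

/-- The function `S(s) = E[L ^ s + R ^ s] - 1`, for `s > 0`, with values in `[-1, ∞]`. -/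
noncomputable def S (P : Measure Ω) (L R : Ω → ℝ) (s : ℝ) : EReal :=
  (powerMoment P L R s : EReal) - 1

/-- The collisional gain operator `ψ ↦ (ξ ↦ E[ψ(L ξ) ψ(R ξ)])` on characteristic functions. -/
noncomputable def gain (P : Measure Ω) (L R : Ω → ℝ) (ψ : ℝ → ℂ) (ξ : ℝ) : ℂ :=
  ∫ ω, ψ (L ω * ξ) * ψ (R ω * ξ) ∂P

/-- `φ`, with `φ t ξ` the value at time `t` and frequency `ξ`, solves for `t ≥ 0` the initial value
problem `∂ₜ φ + φ = gain(φ)` for `t > 0`, `φ(0; ·) = φ₀`; for every `ξ` the function `φ(·; ξ)` is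
differentiable at every `t > 0` and continuous up to `t = 0`. -/
def SolvesBoltzmann (P : Measure Ω) (L R : Ω → ℝ) (φ₀ : ℝ → ℂ) (φ : ℝ → ℝ → ℂ) : Prop :=
  (∀ ξ : ℝ, φ 0 ξ = φ₀ ξ) ∧
  (∀ ξ : ℝ, ContinuousWithinAt (fun t => φ t ξ) (Ici 0) 0) ∧
  (∀ t : ℝ, 0 < t → ∀ ξ : ℝ,
    HasDerivAt (fun r => φ r ξ) (gain P L R (φ t) ξ - φ t ξ) t)

end

/-- The condition that the limits of `x ^ α * (1 - F x)` at `+∞` and of `|x| ^ α * F x` at `-∞`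
exist and are finite (possibly zero), where `F` is the distribution function of the law `μ`. -/
def StableTails (α : ℝ) (μ : Measure ℝ) : Prop :=
  (∃ cplus : ℝ, Tendsto (fun x : ℝ => x ^ α * (1 - cdf μ x)) atTop (𝓝 cplus)) ∧
  (∃ cminus : ℝ, Tendsto (fun x : ℝ => |x| ^ α * cdf μ x) atBot (𝓝 cminus))

/-- The Wasserstein distance of order `γ > 0` between two laws on the real line: the infimum, over
the joint laws `π` of all pairs with marginal laws `μ` and `ν`, of
`(E |X' - Y'| ^ γ) ^ (1 / max γ 1)`. It may be infinite. -/
noncomputable def wasserstein (γ : ℝ) (μ ν : Measure ℝ) : ℝ≥0∞ :=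
  ⨅ (π : Measure (ℝ × ℝ)) (_ : π.map Prod.fst = μ ∧ π.map Prod.snd = ν),
    (∫⁻ z, ENNReal.ofReal (|z.1 - z.2| ^ γ) ∂π) ^ (1 / max γ 1)

/-- The constant `A`: `1` if `γ ≤ 1`, and `2 ^ (1 / γ)` otherwise. -/
noncomputable def constA (γ : ℝ) : ℝ := if γ ≤ 1 then 1 else 2 ^ (1 / γ)

/-- The constant `B`: `1` if `γ ≤ 1`, and `1 / γ` otherwise. -/
noncomputable def constB (γ : ℝ) : ℝ := if γ ≤ 1 then 1 else 1 / γ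

end KineticCLT

/-!
The law of `V t` is the Wild sum started at the law of `X₀`: an average, with geometric weights of
parameter `e⁻ᵗ`, of the laws of the state after `n` random binary collisions `(Z₁, Z₂) ↦ L Z₁ + R
Z₂`. Indeed the characteristic functions of the Wild sum solve the kinetic equation
(`solvesBoltzmann_wildSum`), and solutions that are characteristic functions are unique
(`eq_wildSum_of_solvesBoltzmann`). A limit in distribution as `t → ∞` is reproduced by the
collisions, since the time derivative of the characteristic function converges and can only converge
to `0` (`collide_limit_eq`); so it is stationary for the evolution.

Collisions are linear in the states, hence Wild sums make sense in any normed space and commute with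
linear maps. Let a coupling `π` of `X₀` and `V∞` evolve by collisions in `ℝ × ℝ`. Its marginals are
the evolutions of the two laws, so that at time `t` it couples `V t` with `V∞`
(`wasserstein_wildSum_le`), and the law of the difference of the coordinates evolves by the same
collisions on the line. It remains to show that the `γ`-th absolute moment of the evolution of one
law `δ` decays like `exp (-t |S(γ)|)`. If this moment is subadditive along the collisions, the
recursion defining the Wild convolutions becomes the differential inequality `p' ≤ κ p / (1 - x)`
for the generating function `p` of the moments, with `κ = E[L ^ γ + R ^ γ]`, which gives the decay
(`absMoment_wildSum_le`).

* For `γ ≤ 1` the function `|x| ^ γ` is subadditive.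
* For `1 < γ ≤ 2` subadditivity holds for symmetric laws by Clarkson's inequality. A centered `δ` is
  compared with its symmetrization `Z - Z'`: let two independent copies of `δ` undergo the same
  collisions. Then `E[Z' | Z] = 0` is preserved, whence `E |Z| ^ γ ≤ E |Z - Z'| ^ γ` at later times,
  while initially `E |Z - Z'| ^ γ ≤ 2 E |Z| ^ γ` by a representation of `|x| ^ γ` as an integral of
  `1 - cos (x s)`, or by expanding the square if `γ = 2` (`absMoment_wildSum_le_of_centered`). The
  factor `2` is the origin of `A = 2 ^ (1 / γ)`.

For `γ > 1` one needs that the difference in a coupling of finite cost is centered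
(`integral_id_diffLaw_eq_zero`). Here `1 ≤ α < γ`. If `α = 1`, the mean is conserved and the `γ`-th
moments stay bounded, so that `X₀` and `V∞` have the same mean. If `α > 1`, then `E[L + R] > 1` by
convexity, and the mean of `δ` is multiplied by a factor tending to infinity, while its `γ`-th
moment is at most of the order of the `γ`-th power of this factor
(`absMoment_wildSum_le_meanGrowth`). A family of laws with these properties and nonzero mean is not
tight, but `V t - V∞` is tight under every coupling because `V t` converges in law.
-/

namespace KineticCLT

/-! ### Wild sums -/

section Wild

variable {Ω : Type*} [MeasurableSpace Ω]
variable {E : Type*} [NormedAddCommGroup E] [NormedSpace ℝ E] [MeasurableSpace E] [BorelSpace E]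
  [SecondCountableTopology E]
variable {F : Type*} [NormedAddCommGroup F] [NormedSpace ℝ F] [MeasurableSpace F] [BorelSpace F]
  [SecondCountableTopology F]

/-- The law of `L • Z₁ + R • Z₂`, where `(L, R)`, `Z₁` and `Z₂` are independent and `Z₁`, `Z₂` have
the laws `μ`, `ν`. States may live in any normed space, so that couplings can be evolved too. -/
noncomputable def collide (P : Measure Ω) (L R : Ω → ℝ) (μ ν : Measure E) : Measure E :=
  (P.prod (μ.prod ν)).map (fun p => L p.1 • p.2.1 + R p.1 • p.2.2)

/-- The `n`-th Wild convolution of `μ`: the law of the state after `n` collisions, the last of which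
splits the tree of collisions uniformly into subtrees with `i` and `n - 1 - i` collisions. -/
noncomputable def wild (P : Measure Ω) (L R : Ω → ℝ) (μ : Measure E) : ℕ → Measure E
  | 0 => μ
  | n + 1 => ((n : ℝ≥0∞) + 1)⁻¹ •
      ∑ i : Fin (n + 1), collide P L R (wild P L R μ i) (wild P L R μ (n - i))
  decreasing_by all_goals omega

/-- The Wild sum at time `t`: the mixture of the Wild convolutions with geometric weights
`e⁻ᵗ (1 - e⁻ᵗ) ^ n`. It is the law at time `t` of the kinetic evolution started at `μ`. -/
noncomputable def wildSum (P : Measure Ω) (L R : Ω → ℝ) (μ : Measure E) (t : ℝ) : Measure E :=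
  Measure.sum fun n =>
    ENNReal.ofReal (Real.exp (-t) * (1 - Real.exp (-t)) ^ n) • wild P L R μ n

variable {P : Measure Ω} {L R : Ω → ℝ}

@[simp]
lemma wild_zero (μ : Measure E) : wild P L R μ 0 = μ := by rw [wild]

lemma wild_succ (μ : Measure E) (n : ℕ) :
    wild P L R μ (n + 1) = ((n : ℝ≥0∞) + 1)⁻¹ •
      ∑ i ∈ Finset.range (n + 1), collide P L R (wild P L R μ i) (wild P L R μ (n - i)) := by
  rw [wild, Finset.sum_range]

lemma measurable_collision (hL : Measurable L) (hR : Measurable R) :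
    Measurable (fun p : Ω × E × E => L p.1 • p.2.1 + R p.1 • p.2.2) := by
  fun_prop

lemma isProbabilityMeasure_collide [IsProbabilityMeasure P] (hL : Measurable L) (hR : Measurable R)
    (μ ν : Measure E) [IsProbabilityMeasure μ] [IsProbabilityMeasure ν] :
    IsProbabilityMeasure (collide P L R μ ν) :=
  Measure.isProbabilityMeasure_map (measurable_collision hL hR).aemeasurable

lemma natCast_add_one_ne_top (n : ℕ) : (n : ℝ≥0∞) + 1 ≠ ∞ := by
  exact_mod_cast ENNReal.natCast_ne_top (n + 1)

lemma isProbabilityMeasure_wild [IsProbabilityMeasure P] (hL : Measurable L) (hR : Measurable R)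
    (μ : Measure E) [IsProbabilityMeasure μ] (n : ℕ) : IsProbabilityMeasure (wild P L R μ n) := by
  induction n using Nat.strong_induction_on with
  | _ n ih =>
    cases n with
    | zero => simpa
    | succ n =>
      constructor
      have h : ∀ i ∈ Finset.range (n + 1),
          collide P L R (wild P L R μ i) (wild P L R μ (n - i)) univ = 1 := by
        intro i hi
        rw [Finset.mem_range] at hi
        have := ih i hi
        have := ih (n - i) (by omega)
        have := isProbabilityMeasure_collide (P := P) hL hR (wild P L R μ i) (wild P L R μ (n - i))
        exact measure_univ
      rw [wild_succ, Measure.smul_apply, Measure.finsetSum_apply, Finset.sum_congr rfl h]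
      simp only [Finset.sum_const, Finset.card_range, smul_eq_mul, nsmul_eq_mul, mul_one]
      push_cast
      exact ENNReal.inv_mul_cancel (by simp) (natCast_add_one_ne_top n)

lemma one_sub_exp_neg_mem {t : ℝ} (ht : 0 ≤ t) : 1 - Real.exp (-t) ∈ Ico (0 : ℝ) 1 := by
  have h1 : Real.exp (-t) ≤ 1 := Real.exp_le_one_iff.2 (by linarith)
  have h2 := Real.exp_pos (-t)
  constructor <;> linarith

lemma hasSum_wild_weights {t : ℝ} (ht : 0 ≤ t) :
    HasSum (fun n : ℕ => Real.exp (-t) * (1 - Real.exp (-t)) ^ n) 1 := by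
  have h := one_sub_exp_neg_mem ht
  have h2 := (hasSum_geometric_of_lt_one h.1 h.2).mul_left (Real.exp (-t))
  rwa [sub_sub_cancel, mul_inv_cancel₀ (Real.exp_pos _).ne'] at h2

lemma wild_weight_nonneg {t : ℝ} (ht : 0 ≤ t) (n : ℕ) :
    0 ≤ Real.exp (-t) * (1 - Real.exp (-t)) ^ n :=
  mul_nonneg (Real.exp_pos _).le (pow_nonneg (one_sub_exp_neg_mem ht).1 _)

lemma tsum_wild_weights {t : ℝ} (ht : 0 ≤ t) :
    ∑' n : ℕ, ENNReal.ofReal (Real.exp (-t) * (1 - Real.exp (-t)) ^ n) = 1 := by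
  rw [← ENNReal.ofReal_tsum_of_nonneg (wild_weight_nonneg ht) (hasSum_wild_weights ht).summable,
    (hasSum_wild_weights ht).tsum_eq, ENNReal.ofReal_one]

lemma lintegral_wildSum (μ : Measure E) (t : ℝ) (f : E → ℝ≥0∞) :
    ∫⁻ x, f x ∂(wildSum P L R μ t) =
      ∑' n : ℕ, ENNReal.ofReal (Real.exp (-t) * (1 - Real.exp (-t)) ^ n)
        * ∫⁻ x, f x ∂(wild P L R μ n) := by
  simp [wildSum, lintegral_sum_measure]

lemma isProbabilityMeasure_wildSum [IsProbabilityMeasure P] (hL : Measurable L) (hR : Measurable R)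
    (μ : Measure E) [IsProbabilityMeasure μ] {t : ℝ} (ht : 0 ≤ t) :
    IsProbabilityMeasure (wildSum P L R μ t) := by
  constructor
  have := fun n => isProbabilityMeasure_wild (P := P) hL hR μ n
  rw [← lintegral_one, lintegral_wildSum]
  simpa using tsum_wild_weights ht

lemma lintegral_wild_succ (μ : Measure E) (n : ℕ) (f : E → ℝ≥0∞) :
    ((n : ℝ≥0∞) + 1) * ∫⁻ x, f x ∂(wild P L R μ (n + 1)) = ∑ i ∈ Finset.range (n + 1),
      ∫⁻ x, f x ∂(collide P L R (wild P L R μ i) (wild P L R μ (n - i))) := by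
  rw [wild_succ, lintegral_smul_measure, lintegral_finsetSum_measure, smul_eq_mul, ← mul_assoc,
    ENNReal.mul_inv_cancel (by simp) (natCast_add_one_ne_top n), one_mul]

lemma lintegral_collide (hL : Measurable L) (hR : Measurable R) (μ ν : Measure E)
    {f : E → ℝ≥0∞} (hf : Measurable f) :
    ∫⁻ x, f x ∂(collide P L R μ ν) =
      ∫⁻ p, f (L p.1 • p.2.1 + R p.1 • p.2.2) ∂(P.prod (μ.prod ν)) := by
  rw [collide, lintegral_map hf (measurable_collision hL hR)]

lemma map_collide [SFinite P] (hL : Measurable L) (hR : Measurable R) (μ ν : Measure E) [SFinite μ]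
    [SFinite ν] (T : E →L[ℝ] F) :
    (collide P L R μ ν).map T = collide P L R (μ.map T) (ν.map T) := by
  have hT : Measurable T := T.continuous.measurable
  rw [collide, collide, Measure.map_map hT (measurable_collision hL hR),
    Measure.map_prod_map _ _ hT hT]
  have : P.prod ((μ.prod ν).map (Prod.map T T)) =
      (P.prod (μ.prod ν)).map (Prod.map id (Prod.map T T)) := by
    rw [← Measure.map_prod_map _ _ measurable_id (hT.prodMap hT), Measure.map_id]
  rw [this, Measure.map_map (measurable_collision hL hR)
    (measurable_id.prodMap (hT.prodMap hT))]
  congr 1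
  ext p
  simp

lemma map_wild [IsProbabilityMeasure P] (hL : Measurable L) (hR : Measurable R) (μ : Measure E)
    [IsProbabilityMeasure μ] (T : E →L[ℝ] F) (n : ℕ) :
    (wild P L R μ n).map T = wild P L R (μ.map T) n := by
  have hT : Measurable T := T.continuous.measurable
  have hprob := fun n => isProbabilityMeasure_wild (P := P) hL hR μ n
  induction n using Nat.strong_induction_on with
  | _ n ih =>
    cases n with
    | zero => simp
    | succ n =>
      rw [wild_succ, wild_succ, Measure.map_smul, Measure.map_finset_sum hT.aemeasurable]
      congr 1
      refine Finset.sum_congr rfl fun i hi => ?_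
      rw [Finset.mem_range] at hi
      rw [map_collide hL hR, ih i hi, ih (n - i) (by omega)]

lemma map_wildSum [IsProbabilityMeasure P] (hL : Measurable L) (hR : Measurable R) (μ : Measure E)
    [IsProbabilityMeasure μ] (T : E →L[ℝ] F) (t : ℝ) :
    (wildSum P L R μ t).map T = wildSum P L R (μ.map T) t := by
  have hT : Measurable T := T.continuous.measurable
  rw [wildSum, wildSum, Measure.map_sum hT.aemeasurable]
  simp [map_wild hL hR]

/-- A law reproduced by the collisions is stationary for the whole evolution. -/
lemma wildSum_of_collide_eq {ν : Measure E} (hν : collide P L R ν ν = ν) {t : ℝ}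
    (ht : 0 ≤ t) : wildSum P L R ν t = ν := by
  have h : ∀ n, wild P L R ν n = ν := by
    intro n
    induction n using Nat.strong_induction_on with
    | _ n ih =>
      cases n with
      | zero => simp
      | succ n =>
        rw [wild_succ]
        have : ∀ i ∈ Finset.range (n + 1),
            collide P L R (wild P L R ν i) (wild P L R ν (n - i)) = ν := by
          intro i hi
          rw [Finset.mem_range] at hi
          rw [ih i hi, ih (n - i) (by omega), hν]
        rw [Finset.sum_congr rfl this, Finset.sum_const, Finset.card_range]
        ext s hs
        simp only [Measure.smul_apply, nsmul_eq_mul, smul_eq_mul]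
        push_cast
        rw [← mul_assoc, ENNReal.inv_mul_cancel (by simp) (natCast_add_one_ne_top n), one_mul]
  ext s hs
  rw [wildSum, Measure.sum_apply _ hs]
  simp only [h, Measure.smul_apply, smul_eq_mul]
  rw [ENNReal.tsum_mul_right, tsum_wild_weights ht, one_mul]

end Wild

/-! ### Characteristic functions of Wild sums -/

section CharFun

variable {Ω : Type*} [MeasurableSpace Ω] {P : Measure Ω} {L R : Ω → ℝ}

lemma integral_wild_succ {E G : Type*} [NormedAddCommGroup E] [NormedSpace ℝ E] [MeasurableSpace E]
    [BorelSpace E] [SecondCountableTopology E] [NormedAddCommGroup G] [NormedSpace ℝ G]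
    (μ : Measure E) (n : ℕ) (f : E → G)
    (hf : ∀ i ∈ Finset.range (n + 1),
      Integrable f (collide P L R (wild P L R μ i) (wild P L R μ (n - i)))) :
    ((n : ℝ) + 1) • ∫ x, f x ∂(wild P L R μ (n + 1)) = ∑ i ∈ Finset.range (n + 1),
      ∫ x, f x ∂(collide P L R (wild P L R μ i) (wild P L R μ (n - i))) := by
  rw [wild_succ, integral_smul_measure, integral_finsetSum_measure hf, smul_smul]
  have : ((n : ℝ≥0∞) + 1)⁻¹.toReal = ((n : ℝ) + 1)⁻¹ := by
    rw [ENNReal.toReal_inv, ENNReal.toReal_add (ENNReal.natCast_ne_top n) (by simp)]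
    simp
  rw [this, mul_inv_cancel₀ (by positivity), one_smul]

lemma integral_wildSum {E G : Type*} [NormedAddCommGroup E] [NormedSpace ℝ E] [MeasurableSpace E]
    [BorelSpace E] [SecondCountableTopology E] [NormedAddCommGroup G] [NormedSpace ℝ G]
    (μ : Measure E) {t : ℝ} (ht : 0 ≤ t) {f : E → G}
    (hf : Integrable f (wildSum P L R μ t)) :
    HasSum (fun n : ℕ => (Real.exp (-t) * (1 - Real.exp (-t)) ^ n) • ∫ x, f x ∂(wild P L R μ n))
      (∫ x, f x ∂(wildSum P L R μ t)) := by
  have h := hasSum_integral_measure (f := f) hf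
  simp only [integral_smul_measure, ENNReal.toReal_ofReal (wild_weight_nonneg ht _)] at h
  exact h

lemma continuous_charFun (μ : Measure ℝ) [IsFiniteMeasure μ] : Continuous (charFun μ) := by
  fun_prop

lemma charFun_collide [IsProbabilityMeasure P] (hL : Measurable L) (hR : Measurable R)
    (μ ν : Measure ℝ) [IsProbabilityMeasure μ] [IsProbabilityMeasure ν] (ξ : ℝ) :
    charFun (collide P L R μ ν) ξ = ∫ ω, charFun μ (L ω * ξ) * charFun ν (R ω * ξ) ∂P := by
  have hm := measurable_collision (E := ℝ) hL hR
  rw [charFun_apply_real, collide, integral_map hm.aemeasurable (by fun_prop), integral_prod]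
  · congr 1
    ext ω
    rw [charFun_apply_real, charFun_apply_real, ← integral_prod_mul]
    congr 1
    ext p
    rw [← Complex.exp_add]
    congr 1
    simp
    ring
  · refine Integrable.of_bound (C := 1) ?_ (ae_of_all _ fun p => ?_)
    · exact (Measurable.aestronglyMeasurable (by fun_prop))
    · rw [← Complex.ofReal_mul, Complex.norm_exp_ofReal_mul_I]

/-- A power series with bounded coefficients may be differentiated termwise inside the unit disc. -/
lemma hasDerivAt_tsum_pow_mul {p : ℕ → ℂ} (hp : ∀ n, ‖p n‖ ≤ 1) {x : ℝ} (hx : |x| < 1) :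
    HasDerivAt (fun y : ℝ => ∑' n : ℕ, (y : ℂ) ^ n * p n)
      (∑' n : ℕ, (x : ℂ) ^ n * (((n : ℝ) + 1) • p (n + 1))) x := by
  obtain ⟨r, hxr, hr1⟩ := exists_between hx
  have hr0 : 0 ≤ r := (abs_nonneg x).trans hxr.le
  have hu : Summable fun n : ℕ => (n : ℝ) * r ^ (n - 1) := by
    have h := summable_pow_mul_geometric_of_norm_lt_one 1 (r := r)
      (by rwa [Real.norm_of_nonneg hr0])
    have h2 := summable_geometric_of_lt_one hr0 hr1
    refine (summable_nat_add_iff 1).1 ((h.add h2).congr fun n => ?_)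
    simp
    ring
  have key := hasDerivAt_tsum_of_isPreconnected (𝕜 := ℝ) (t := Ioo (-r) r)
    (g := fun (n : ℕ) (y : ℝ) => (y : ℂ) ^ n * p n)
    (g' := fun (n : ℕ) (y : ℝ) => ((n : ℂ) * (y : ℂ) ^ (n - 1)) * p n) (y₀ := 0) (y := x)
    hu isOpen_Ioo isPreconnected_Ioo ?_ ?_ ?_ ?_ ?_
  · have hs : Summable fun n : ℕ => ((n : ℂ) * (x : ℂ) ^ (n - 1)) * p n := by
      refine Summable.of_norm_bounded hu fun n => ?_
      rw [norm_mul, norm_mul, norm_pow, Complex.norm_natCast, Complex.norm_real, Real.norm_eq_abs]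
      calc (n : ℝ) * |x| ^ (n - 1) * ‖p n‖ ≤ n * r ^ (n - 1) * 1 := by gcongr; exact hp n
        _ = _ := mul_one _
    refine key.congr_deriv ?_
    rw [hs.tsum_eq_zero_add]
    simp only [CharP.cast_eq_zero, zero_mul, zero_add, Nat.add_sub_cancel]
    refine tsum_congr fun n => ?_
    rw [Complex.real_smul]
    push_cast
    ring
  · intro n y _
    have h := ((hasDerivAt_pow n (y : ℂ)).comp_ofReal).mul_const (p n)
    simpa using h
  · intro n y hy
    rw [norm_mul, norm_mul, norm_pow, Complex.norm_natCast, Complex.norm_real, Real.norm_eq_abs]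
    have hy' : |y| ≤ r := abs_le.2 ⟨hy.1.le, hy.2.le⟩
    calc (n : ℝ) * |y| ^ (n - 1) * ‖p n‖ ≤ n * r ^ (n - 1) * 1 := by gcongr; exact hp n
      _ = _ := mul_one _
  · have := (abs_nonneg x).trans_lt hxr
    constructor <;> linarith
  · refine summable_of_ne_finset_zero (s := {0}) fun n hn => ?_
    simp only [Finset.mem_singleton] at hn
    simp [hn]
  · exact abs_lt.1 hxr

variable [IsProbabilityMeasure P]

lemma norm_charFun_wild_le (hL : Measurable L) (hR : Measurable R) (μ : Measure ℝ)
    [IsProbabilityMeasure μ] (n : ℕ) (ξ : ℝ) : ‖charFun (wild P L R μ n) ξ‖ ≤ 1 := by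
  have := isProbabilityMeasure_wild (P := P) hL hR μ n
  exact norm_charFun_le_one ξ

lemma succ_smul_charFun_wild (hL : Measurable L) (hR : Measurable R) (μ : Measure ℝ)
    [IsProbabilityMeasure μ] (n : ℕ) (ξ : ℝ) :
    ((n : ℝ) + 1) • charFun (wild P L R μ (n + 1)) ξ = ∑ i ∈ Finset.range (n + 1),
      ∫ ω, charFun (wild P L R μ i) (L ω * ξ) * charFun (wild P L R μ (n - i)) (R ω * ξ) ∂P := by
  have hw := fun n => isProbabilityMeasure_wild (P := P) hL hR μ n
  have hc := fun i j => isProbabilityMeasure_collide (P := P) hL hR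
    (wild P L R μ i) (wild P L R μ j)
  rw [charFun_apply_real, integral_wild_succ]
  · refine Finset.sum_congr rfl fun i _ => ?_
    rw [← charFun_collide hL hR, charFun_apply_real]
  · intro i _
    refine Integrable.of_bound (C := 1) ?_ (ae_of_all _ fun x => ?_)
    · exact (Measurable.aestronglyMeasurable (by fun_prop))
    · rw [← Complex.ofReal_mul, Complex.norm_exp_ofReal_mul_I]

lemma charFun_wildSum (hL : Measurable L) (hR : Measurable R) (μ : Measure ℝ)
    [IsProbabilityMeasure μ] {t : ℝ} (ht : 0 ≤ t) (ξ : ℝ) :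
    charFun (wildSum P L R μ t) ξ =
      Complex.exp (-t) * ∑' n : ℕ, ((1 - Real.exp (-t) : ℝ) : ℂ) ^ n
        * charFun (wild P L R μ n) ξ := by
  have := isProbabilityMeasure_wildSum (P := P) hL hR μ ht
  rw [charFun_apply_real, ← (integral_wildSum μ ht _).tsum_eq, ← tsum_mul_left]
  · refine tsum_congr fun n => ?_
    rw [Complex.real_smul, charFun_apply_real]
    push_cast
    ring
  · refine Integrable.of_bound (C := 1) ?_ (ae_of_all _ fun x => ?_)
    · exact (Measurable.aestronglyMeasurable (by fun_prop))
    · rw [← Complex.ofReal_mul, Complex.norm_exp_ofReal_mul_I]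

lemma summable_pow_mul {p : ℕ → ℂ} (hp : ∀ n, ‖p n‖ ≤ 1) {x : ℝ} (hx : |x| < 1) :
    Summable fun n => ‖(x : ℂ) ^ n * p n‖ := by
  refine Summable.of_nonneg_of_le (fun _ => norm_nonneg _) (fun n => ?_)
    (summable_geometric_of_lt_one (abs_nonneg x) hx)
  rw [norm_mul, norm_pow, Complex.norm_real, Real.norm_eq_abs]
  exact mul_le_of_le_one_right (by positivity) (hp n)

/-- The recursion defining the Wild convolutions is the gain operator, read off on generating
functions by the Cauchy product formula. -/
lemma tsum_succ_smul_charFun_wild (hL : Measurable L) (hR : Measurable R) (μ : Measure ℝ)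
    [IsProbabilityMeasure μ] {x : ℝ} (hx : |x| < 1) (ξ : ℝ) :
    ∑' n : ℕ, (x : ℂ) ^ n * (((n : ℝ) + 1) • charFun (wild P L R μ (n + 1)) ξ) =
      gain P L R (fun η => ∑' n : ℕ, (x : ℂ) ^ n * charFun (wild P L R μ n) η) ξ := by
  have hw := fun n => isProbabilityMeasure_wild (P := P) hL hR μ n
  have hp := norm_charFun_wild_le (P := P) hL hR μ
  have hcont : ∀ n, Measurable (charFun (wild P L R μ n)) := fun n =>
    (continuous_charFun _).measurable
  have hint : ∀ i j, Integrable (fun ω => charFun (wild P L R μ i) (L ω * ξ)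
      * charFun (wild P L R μ j) (R ω * ξ)) P := by
    intro i j
    refine Integrable.of_bound (C := 1) (Measurable.aestronglyMeasurable (by fun_prop))
      (ae_of_all _ fun ω => ?_)
    rw [norm_mul]
    exact mul_le_one₀ (hp _ _) (norm_nonneg _) (hp _ _)
  set G : ℕ → Ω → ℂ := fun n ω => (x : ℂ) ^ n * ∑ i ∈ Finset.range (n + 1),
    charFun (wild P L R μ i) (L ω * ξ) * charFun (wild P L R μ (n - i)) (R ω * ξ) with hG
  have hGint : ∀ n, Integrable (G n) P := fun n =>
    (integrable_finsetSum _ fun i _ => hint i (n - i)).const_mul _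
  have hGbound : ∀ n ω, ‖G n ω‖ ≤ |x| ^ n * (n + 1) := by
    intro n ω
    rw [hG, norm_mul, norm_pow, Complex.norm_real, Real.norm_eq_abs]
    gcongr
    refine (norm_sum_le_of_le _ (fun i _ => ?_)).trans_eq (b := ∑ i ∈ Finset.range (n + 1), (1 : ℝ))
      (by simp)
    rw [norm_mul]
    exact mul_le_one₀ (hp _ _) (norm_nonneg _) (hp _ _)
  have hsum : Summable fun n : ℕ => |x| ^ n * ((n : ℝ) + 1) := by
    have h := summable_pow_mul_geometric_of_norm_lt_one 1 (r := |x|) (by simpa using hx)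
    refine (h.add (summable_geometric_of_lt_one (abs_nonneg x) hx)).congr fun n => ?_
    ring
  have h1 : ∀ n : ℕ, (x : ℂ) ^ n * (((n : ℝ) + 1) • charFun (wild P L R μ (n + 1)) ξ)
      = ∫ ω, G n ω ∂P := by
    intro n
    rw [succ_smul_charFun_wild hL hR, integral_const_mul,
      integral_finsetSum _ fun i _ => hint i (n - i)]
  rw [tsum_congr h1, gain, integral_tsum_of_summable_integral_norm hGint]
  · congr 1
    ext ω
    rw [tsum_mul_tsum_eq_tsum_sum_range_of_summable_norm
      (summable_pow_mul (fun n => hp n _) hx) (summable_pow_mul (fun n => hp n _) hx)]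
    refine tsum_congr fun n => ?_
    simp only [hG, Finset.mul_sum]
    refine Finset.sum_congr rfl fun i hi => ?_
    have : (x : ℂ) ^ n = (x : ℂ) ^ i * (x : ℂ) ^ (n - i) := by
      rw [Finset.mem_range] at hi
      rw [← pow_add]
      congr 1
      omega
    rw [this]
    ring
  · refine Summable.of_nonneg_of_le (fun n => integral_nonneg fun ω => norm_nonneg _)
      (fun n => ?_) hsum
    refine (integral_mono_of_nonneg (ae_of_all _ fun ω => norm_nonneg _) (integrable_const _)
      (ae_of_all _ (hGbound n))).trans_eq (by simp)

/-- The Wild sum solves the kinetic equation. -/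
theorem solvesBoltzmann_wildSum (hL : Measurable L) (hR : Measurable R) (μ : Measure ℝ)
    [IsProbabilityMeasure μ] :
    SolvesBoltzmann P L R (charFun μ) (fun t => charFun (wildSum P L R μ t)) := by
  have hp := norm_charFun_wild_le (P := P) hL hR μ
  have hder : ∀ t : ℝ, 0 ≤ t → ∀ ξ, HasDerivAt (fun s : ℝ => Complex.exp (-s) *
      ∑' n : ℕ, ((1 - Real.exp (-s) : ℝ) : ℂ) ^ n * charFun (wild P L R μ n) ξ)
      (gain P L R (charFun (wildSum P L R μ t)) ξ - charFun (wildSum P L R μ t) ξ) t := by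
    intro t ht ξ
    have hx : |1 - Real.exp (-t)| < 1 := by
      rw [abs_of_nonneg (one_sub_exp_neg_mem ht).1]
      exact (one_sub_exp_neg_mem ht).2
    have h1 : HasDerivAt (fun s : ℝ => 1 - Real.exp (-s)) (Real.exp (-t)) t := by
      have := ((hasDerivAt_neg t).exp).const_sub 1
      simpa using this
    have h2 : HasDerivAt (fun s : ℝ => Complex.exp (-s)) (-Complex.exp (-t)) t := by
      have := (((hasDerivAt_neg t).exp)).ofReal_comp
      simpa using this
    have h3 := (hasDerivAt_tsum_pow_mul (fun n => hp n ξ) hx).scomp t h1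
    rw [tsum_succ_smul_charFun_wild hL hR μ hx] at h3
    have h4 := h2.mul h3
    refine h4.congr_deriv ?_
    rw [charFun_wildSum hL hR μ ht]
    have : gain P L R (charFun (wildSum P L R μ t)) ξ = Complex.exp (-t) * (Complex.exp (-t) *
        gain P L R (fun η => ∑' n : ℕ, ((1 - Real.exp (-t) : ℝ) : ℂ) ^ n
          * charFun (wild P L R μ n) η) ξ) := by
      rw [gain, gain, ← integral_const_mul, ← integral_const_mul]
      congr 1
      ext ω
      rw [charFun_wildSum hL hR μ ht, charFun_wildSum hL hR μ ht]
      ring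
    rw [this, Complex.real_smul]
    push_cast
    simp only [Function.comp_apply]
    push_cast
    ring
  refine ⟨fun ξ => ?_, fun ξ => ?_, fun t ht ξ => ?_⟩
  · simp only [charFun_wildSum hL hR μ le_rfl]
    simp only [Complex.ofReal_zero, neg_zero, Complex.exp_zero, Real.exp_zero, sub_self, one_mul]
    rw [tsum_eq_single 0]
    · simp
    · intro n hn
      simp [hn]
  · refine ((hder 0 le_rfl ξ).continuousAt.continuousWithinAt (s := Ici 0)).congr ?_ ?_
    · intro t ht
      exact charFun_wildSum hL hR μ ht ξ
    · exact charFun_wildSum hL hR μ le_rfl ξ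
  · refine (hder t ht.le ξ).congr_of_eventuallyEq ?_
    filter_upwards [Ioi_mem_nhds ht] with s hs
    exact charFun_wildSum hL hR μ (le_of_lt hs) ξ

end CharFun

/-! ### Uniqueness for the kinetic equation and stationarity of the limit -/

section Boltzmann

variable {Ω : Type*} [MeasurableSpace Ω] {P : Measure Ω} [IsProbabilityMeasure P] {L R : Ω → ℝ}

lemma norm_gain_sub_gain_le (hL : Measurable L) (hR : Measurable R) {ψ₁ ψ₂ : ℝ → ℂ}
    (hm₁ : Measurable ψ₁) (hm₂ : Measurable ψ₂) (h₁ : ∀ ξ, ‖ψ₁ ξ‖ ≤ 1) (h₂ : ∀ ξ, ‖ψ₂ ξ‖ ≤ 1)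
    {M : ℝ} (hM : ∀ ξ, ‖ψ₁ ξ - ψ₂ ξ‖ ≤ M) (ξ : ℝ) :
    ‖gain P L R ψ₁ ξ - gain P L R ψ₂ ξ‖ ≤ 2 * M := by
  have hint : ∀ ψ : ℝ → ℂ, Measurable ψ → (∀ ξ, ‖ψ ξ‖ ≤ 1) →
      Integrable (fun ω => ψ (L ω * ξ) * ψ (R ω * ξ)) P := by
    intro ψ hm h
    refine Integrable.of_bound (C := 1) (Measurable.aestronglyMeasurable (by fun_prop))
      (ae_of_all _ fun ω => ?_)
    rw [norm_mul]
    exact mul_le_one₀ (h _) (norm_nonneg _) (h _)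
  rw [gain, gain, ← integral_sub (hint ψ₁ hm₁ h₁) (hint ψ₂ hm₂ h₂)]
  refine (norm_integral_le_of_norm_le_const (C := 2 * M) (ae_of_all _ fun ω => ?_)).trans_eq
    (by simp)
  have hM0 : 0 ≤ M := (norm_nonneg _).trans (hM 0)
  calc ‖ψ₁ (L ω * ξ) * ψ₁ (R ω * ξ) - ψ₂ (L ω * ξ) * ψ₂ (R ω * ξ)‖
      = ‖ψ₁ (L ω * ξ) * (ψ₁ (R ω * ξ) - ψ₂ (R ω * ξ))
        + (ψ₁ (L ω * ξ) - ψ₂ (L ω * ξ)) * ψ₂ (R ω * ξ)‖ := by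
        congr 1
        ring
    _ ≤ ‖ψ₁ (L ω * ξ)‖ * ‖ψ₁ (R ω * ξ) - ψ₂ (R ω * ξ)‖
        + ‖ψ₁ (L ω * ξ) - ψ₂ (L ω * ξ)‖ * ‖ψ₂ (R ω * ξ)‖ := by
        refine (norm_add_le _ _).trans ?_
        rw [norm_mul, norm_mul]
    _ ≤ 1 * M + M * 1 := by gcongr <;> first | exact h₁ _ | exact h₂ _ | exact hM _
    _ = 2 * M := by ring

/-- Uniqueness for the kinetic equation among characteristic functions, which is proved by Picard
iteration: the difference of two solutions is at most `2 (3 t) ^ n / n!` for every `n`. -/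
theorem SolvesBoltzmann.unique (hL : Measurable L) (hR : Measurable R) {φ₀ : ℝ → ℂ}
    {φ₁ φ₂ : ℝ → ℝ → ℂ} (hφ₁ : SolvesBoltzmann P L R φ₀ φ₁) (hφ₂ : SolvesBoltzmann P L R φ₀ φ₂)
    (hm₁ : ∀ t, 0 ≤ t → Measurable (φ₁ t)) (hm₂ : ∀ t, 0 ≤ t → Measurable (φ₂ t))
    (h₁ : ∀ t, 0 ≤ t → ∀ ξ, ‖φ₁ t ξ‖ ≤ 1) (h₂ : ∀ t, 0 ≤ t → ∀ ξ, ‖φ₂ t ξ‖ ≤ 1)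
    {t : ℝ} (ht : 0 ≤ t) : φ₁ t = φ₂ t := by
  have hcont : ∀ ξ, ContinuousOn (fun s => φ₁ s ξ - φ₂ s ξ) (Ici 0) := by
    intro ξ s hs
    rcases (mem_Ici.1 hs).eq_or_lt with rfl | hs
    · exact (hφ₁.2.1 ξ).sub (hφ₂.2.1 ξ)
    · exact ((hφ₁.2.2 s hs ξ).sub (hφ₂.2.2 s hs ξ)).continuousAt.continuousWithinAt
  have key : ∀ n : ℕ, ∀ s, 0 ≤ s → ∀ ξ,
      ‖φ₁ s ξ - φ₂ s ξ‖ ≤ 2 * ((3 * s) ^ n / n.factorial) := by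
    intro n
    induction n with
    | zero =>
      intro s hs ξ
      have := norm_sub_le (φ₁ s ξ) (φ₂ s ξ)
      have := h₁ s hs ξ
      have := h₂ s hs ξ
      simp only [pow_zero, Nat.factorial_zero, Nat.cast_one, div_one]
      linarith
    | succ n ih =>
      intro s hs ξ
      rcases hs.eq_or_lt with rfl | hs
      · rw [hφ₁.1, hφ₂.1, sub_self, norm_zero]
        positivity
      -- The equation holds for positive times only, so that one starts at `ε` and lets `ε → 0`.
      have hε : ∀ ε ∈ Ioo 0 s, ‖φ₁ s ξ - φ₂ s ξ‖ ≤
          ‖φ₁ ε ξ - φ₂ ε ξ‖ + 2 * ((3 * s) ^ (n + 1) / (n + 1).factorial) := by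
        intro ε hε
        refine image_norm_le_of_norm_deriv_right_le_deriv_boundary
          (f := fun s => φ₁ s ξ - φ₂ s ξ)
          (f' := fun s => (gain P L R (φ₁ s) ξ - φ₁ s ξ) - (gain P L R (φ₂ s) ξ - φ₂ s ξ))
          (B := fun s => ‖φ₁ ε ξ - φ₂ ε ξ‖ + 2 * ((3 * s) ^ (n + 1) / (n + 1).factorial))
          (B' := fun s => 3 * (2 * ((3 * s) ^ n / n.factorial)))
          (a := ε) (b := s) ?_ ?_ ?_ ?_ ?_ ⟨hε.2.le, le_rfl⟩
        · exact (hcont ξ).mono fun r hr => hε.1.le.trans hr.1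
        · intro r hr
          have hr0 : 0 < r := hε.1.trans_le hr.1
          exact ((hφ₁.2.2 r hr0 ξ).sub (hφ₂.2.2 r hr0 ξ)).hasDerivWithinAt
        · have := hε.1
          have : 0 ≤ 2 * ((3 * ε) ^ (n + 1) / ((n + 1).factorial : ℝ)) := by positivity
          linarith
        · intro r
          have h := (((hasDerivAt_id r).const_mul 3).pow (n + 1)).div_const
            ((n + 1).factorial : ℝ)
          refine ((h.const_mul 2).const_add _).congr_deriv ?_
          rw [Nat.factorial_succ]
          push_cast
          field_simp
          simp
        · intro r hr
          have hr0 : 0 ≤ r := hε.1.le.trans hr.1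
          have hg := norm_gain_sub_gain_le (P := P) hL hR (hm₁ r hr0) (hm₂ r hr0) (h₁ r hr0)
            (h₂ r hr0) (ih r hr0) ξ
          have hd := ih r hr0 ξ
          calc _ = ‖(gain P L R (φ₁ r) ξ - gain P L R (φ₂ r) ξ) - (φ₁ r ξ - φ₂ r ξ)‖ := by
                congr 1
                ring
            _ ≤ _ := norm_sub_le _ _
            _ ≤ _ := by linarith
      have hlim : Tendsto (fun ε => ‖φ₁ ε ξ - φ₂ ε ξ‖
          + 2 * ((3 * s) ^ (n + 1) / (n + 1).factorial)) (𝓝[>] 0)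
          (𝓝 (‖φ₁ 0 ξ - φ₂ 0 ξ‖ + 2 * ((3 * s) ^ (n + 1) / (n + 1).factorial))) :=
        ((((hcont ξ) 0 (mem_Ici.2 le_rfl)).mono_left
          (nhdsWithin_mono 0 Ioi_subset_Ici_self)).norm).add_const _
      rw [hφ₁.1, hφ₂.1, sub_self, norm_zero, zero_add] at hlim
      refine ge_of_tendsto hlim ?_
      filter_upwards [Ioo_mem_nhdsGT hs] with ε h using hε ε h
  ext ξ
  have hlim : Tendsto (fun n : ℕ => 2 * ((3 * t) ^ n / (n.factorial : ℝ))) atTop (𝓝 (2 * 0)) :=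
    (FloorSemiring.tendsto_pow_div_factorial_atTop (3 * t)).const_mul 2
  have h := ge_of_tendsto' hlim fun n => key n t ht ξ
  rw [mul_zero] at h
  exact sub_eq_zero.1 (norm_le_zero_iff.1 h)

/-- The limit of a solution as `t → ∞` is a fixed point of the gain operator: the time derivative
converges, and its limit can only be `0`. -/
theorem SolvesBoltzmann.gain_limit (hL : Measurable L) (hR : Measurable R) {φ₀ ψ : ℝ → ℂ}
    {φ : ℝ → ℝ → ℂ} (hφ : SolvesBoltzmann P L R φ₀ φ) (hm : ∀ t, Measurable (φ t))
    (hb : ∀ t ξ, ‖φ t ξ‖ ≤ 1) (hlim : ∀ ξ, Tendsto (fun t => φ t ξ) atTop (𝓝 (ψ ξ))) (ξ : ℝ) :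
    gain P L R ψ ξ = ψ ξ := by
  have hgain : Tendsto (fun t => gain P L R (φ t) ξ) atTop (𝓝 (gain P L R ψ ξ)) := by
    refine tendsto_integral_filter_of_dominated_convergence (fun _ => 1)
      (Eventually.of_forall fun t => ?_) (Eventually.of_forall fun t => ae_of_all _ fun ω => ?_)
      (integrable_const _) (ae_of_all _ fun ω => (hlim _).mul (hlim _))
    · have := hm t
      exact Measurable.aestronglyMeasurable (by fun_prop)
    · rw [norm_mul]
      exact mul_le_one₀ (hb _ _) (norm_nonneg _) (hb _ _)
  set c := gain P L R ψ ξ - ψ ξ with hc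
  have hder : Tendsto (fun t => gain P L R (φ t) ξ - φ t ξ) atTop (𝓝 c) := hgain.sub (hlim ξ)
  have hincr : Tendsto (fun t => φ (t + 1) ξ - φ t ξ) atTop (𝓝 c) := by
    rw [Metric.tendsto_atTop] at hder ⊢
    intro ε hε
    obtain ⟨N, hN⟩ := hder (ε / 2) (half_pos hε)
    refine ⟨max N 1, fun t ht => ?_⟩
    have hpos : 0 < t := lt_of_lt_of_le one_pos ((le_max_right _ _).trans ht)
    have h := (convex_Icc t (t + 1)).norm_image_sub_le_of_norm_hasDerivWithin_le
      (f := fun s => φ s ξ - s • c) (f' := fun s => (gain P L R (φ s) ξ - φ s ξ) - (1 : ℝ) • c)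
      (C := ε / 2) (x := t) (y := t + 1) ?_ ?_ ⟨le_rfl, by linarith⟩ ⟨by linarith, le_rfl⟩
    · rw [dist_eq_norm]
      calc ‖φ (t + 1) ξ - φ t ξ - c‖ = ‖(φ (t + 1) ξ - (t + 1) • c) - (φ t ξ - t • c)‖ := by
            congr 1
            rw [add_smul, one_smul]
            ring
        _ ≤ ε / 2 * ‖t + 1 - t‖ := h
        _ < ε := by
            simp only [add_sub_cancel_left, norm_one, mul_one]
            linarith
    · intro s hs
      exact ((hφ.2.2 s (hpos.trans_le hs.1) ξ).sub
        ((hasDerivAt_id s).smul_const c)).hasDerivWithinAt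
    · intro s hs
      have := hN s (((le_max_left _ _).trans ht).trans hs.1)
      rw [dist_eq_norm] at this
      rw [one_smul]
      exact this.le
  have h0 : Tendsto (fun t => φ (t + 1) ξ - φ t ξ) atTop (𝓝 (ψ ξ - ψ ξ)) :=
    ((hlim ξ).comp (tendsto_atTop_add_const_right _ 1 tendsto_id)).sub (hlim ξ)
  have := tendsto_nhds_unique hincr h0
  rw [sub_self, hc] at this
  exact sub_eq_zero.1 this

/-- The law at time `t` of any solution with values in characteristic functions is the Wild sum. -/
theorem eq_wildSum_of_solvesBoltzmann (hL : Measurable L) (hR : Measurable R) {μ₀ : Measure ℝ}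
    [IsProbabilityMeasure μ₀] {μ : ℝ → Measure ℝ} [∀ t, IsProbabilityMeasure (μ t)]
    (h : SolvesBoltzmann P L R (charFun μ₀) (fun t => charFun (μ t))) {t : ℝ} (ht : 0 ≤ t) :
    μ t = wildSum P L R μ₀ t := by
  have hw := fun t (ht : 0 ≤ t) => isProbabilityMeasure_wildSum (P := P) hL hR μ₀ ht
  have := hw t ht
  refine Measure.ext_of_charFun ?_
  refine h.unique hL hR (solvesBoltzmann_wildSum hL hR μ₀) (fun t _ => ?_) (fun t ht => ?_)
    (fun t _ ξ => ?_) (fun t ht ξ => ?_) ht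
  · exact (continuous_charFun _).measurable
  · have := hw t ht
    exact (continuous_charFun _).measurable
  · exact norm_charFun_le_one ξ
  · have := hw t ht
    exact norm_charFun_le_one ξ

/-- The weak limit of a solution is reproduced by the collisions. -/
theorem collide_limit_eq (hL : Measurable L) (hR : Measurable R) {φ₀ : ℝ → ℂ} {μ : ℝ → Measure ℝ}
    [∀ t, IsProbabilityMeasure (μ t)] {ν : Measure ℝ} [IsProbabilityMeasure ν]
    (h : SolvesBoltzmann P L R φ₀ (fun t => charFun (μ t)))
    (hlim : ∀ ξ, Tendsto (fun t => charFun (μ t) ξ) atTop (𝓝 (charFun ν ξ))) :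
    collide P L R ν ν = ν := by
  have := isProbabilityMeasure_collide (P := P) hL hR ν ν
  refine Measure.ext_of_charFun ?_
  ext ξ
  rw [charFun_collide hL hR]
  exact h.gain_limit hL hR (fun t => (continuous_charFun _).measurable)
    (fun t ξ => norm_charFun_le_one ξ) hlim ξ

end Boltzmann

/-! ### The recursion satisfied by moments of Wild convolutions -/

section Recursion

lemma one_sub_mul_sum_pow_mul_sum (y : ℕ → ℝ) (x : ℝ) (N : ℕ) :
    (1 - x) * ∑ n ∈ Finset.range N, x ^ n * ∑ j ∈ Finset.range (n + 1), y j
      + x ^ N * ∑ j ∈ Finset.range N, y j = ∑ n ∈ Finset.range N, y n * x ^ n := by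
  induction N with
  | zero => simp
  | succ N ih =>
    rw [Finset.sum_range_succ, Finset.sum_range_succ (fun n => y n * x ^ n), ← ih,
      Finset.sum_range_succ y N]
    ring

/-- A discrete Gronwall estimate on the generating function `p` of a sequence satisfying the Wild
recursion. Up to the source `h`, it says that `p' ≤ κ p / (1 - x)`. -/
lemma one_sub_mul_sum_le_of_recursion {y h : ℕ → ℝ} {κ H K x₀ : ℝ} (hy : ∀ n, 0 ≤ y n)
    (hκ : 0 ≤ κ) (hK : 0 ≤ K) (hHK : H ≤ K * (1 - κ))
    (hrec : ∀ n : ℕ, ((n : ℝ) + 1) * y (n + 1) ≤ κ * ∑ j ∈ Finset.range (n + 1), y j + h n)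
    (hx₀ : x₀ ∈ Ico (0 : ℝ) 1)
    (hh : ∀ x ∈ Icc 0 x₀, ∀ N, ∑ n ∈ Finset.range N, h n * x ^ n ≤ H / (1 - x) ^ 2) (N : ℕ) :
    (1 - x₀) * ∑ n ∈ Finset.range (N + 1), y n * x₀ ^ n ≤ y 0 * (1 - x₀) ^ (1 - κ) + K := by
  set p : ℝ → ℝ := fun x => ∑ n ∈ Finset.range (N + 1), y n * x ^ n with hp
  set p' : ℝ → ℝ := fun x => ∑ n ∈ Finset.range N, ((n : ℝ) + 1) * y (n + 1) * x ^ n with hp'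
  have hpder : ∀ x, HasDerivAt p (p' x) x := by
    intro x
    have h1 : HasDerivAt p (∑ n ∈ Finset.range (N + 1), y n * (n * x ^ (n - 1))) x :=
      HasDerivAt.fun_sum fun n _ => (hasDerivAt_pow n x).const_mul (y n)
    refine h1.congr_deriv ?_
    rw [Finset.sum_range_succ', hp']
    simp only [CharP.cast_eq_zero, zero_mul, mul_zero, add_zero, Nat.add_sub_cancel]
    refine Finset.sum_congr rfl fun n _ => ?_
    push_cast
    ring
  have hbound : ∀ x ∈ Icc 0 x₀, (1 - x) * p' x ≤ κ * p x + H / (1 - x) := by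
    intro x hx
    have hx1 : 0 < 1 - x := by linarith [hx.2, hx₀.2]
    have e1 : p' x ≤ κ * ∑ n ∈ Finset.range N, x ^ n * ∑ j ∈ Finset.range (n + 1), y j
        + H / (1 - x) ^ 2 := by
      calc p' x ≤ ∑ n ∈ Finset.range N,
            (κ * (x ^ n * ∑ j ∈ Finset.range (n + 1), y j) + h n * x ^ n) := by
            refine Finset.sum_le_sum fun n _ => ?_
            have := mul_le_mul_of_nonneg_right (hrec n) (pow_nonneg hx.1 n)
            linarith
        _ ≤ _ := by
            rw [Finset.sum_add_distrib, ← Finset.mul_sum]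
            linarith [hh x hx N]
    have e2 := one_sub_mul_sum_pow_mul_sum y x N
    have e3 : 0 ≤ x ^ N * ∑ j ∈ Finset.range N, y j :=
      mul_nonneg (pow_nonneg hx.1 _) (Finset.sum_nonneg fun j _ => hy j)
    have e4 : ∑ n ∈ Finset.range N, y n * x ^ n ≤ p x := by
      simp only [hp]
      rw [Finset.sum_range_succ]
      have := mul_nonneg (hy N) (pow_nonneg hx.1 N)
      linarith
    calc (1 - x) * p' x ≤ (1 - x) * (κ * ∑ n ∈ Finset.range N, x ^ n *
          ∑ j ∈ Finset.range (n + 1), y j + H / (1 - x) ^ 2) := by gcongr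
      _ = κ * ((1 - x) * ∑ n ∈ Finset.range N, x ^ n * ∑ j ∈ Finset.range (n + 1), y j)
          + H / (1 - x) := by field_simp
      _ ≤ κ * p x + H / (1 - x) := by gcongr; linarith
  -- `(1 - x) ^ κ` is the integrating factor of `p' = κ p / (1 - x)`, and the second term of `Φ`
  -- makes up for the source.
  set Φ : ℝ → ℝ := fun x => (1 - x) ^ κ * p x - K * (1 - x) ^ (κ - 1) with hΦ
  have hΦder : ∀ x ∈ Icc 0 x₀, HasDerivAt Φ ((-1 * κ * (1 - x) ^ (κ - 1)) * p x
      + (1 - x) ^ κ * p' x - K * (-1 * (κ - 1) * (1 - x) ^ (κ - 1 - 1))) x := by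
    intro x hx
    have hx1 : 0 < 1 - x := by linarith [hx.2, hx₀.2]
    have h1 : HasDerivAt (fun x : ℝ => 1 - x) (-1) x := by
      simpa using (hasDerivAt_id x).const_sub 1
    exact ((h1.rpow_const (Or.inl hx1.ne')).mul (hpder x)).sub
      ((h1.rpow_const (Or.inl hx1.ne')).const_mul K)
  have hanti : AntitoneOn Φ (Icc 0 x₀) := by
    refine antitoneOn_of_deriv_nonpos (convex_Icc 0 x₀)
      (fun x hx => (hΦder x hx).continuousAt.continuousWithinAt)
      (fun x hx => (hΦder x (interior_subset hx)).differentiableAt.differentiableWithinAt)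
      fun x hx => ?_
    replace hx := interior_subset hx
    have hx1 : 0 < 1 - x := by linarith [hx.2, hx₀.2]
    rw [(hΦder x hx).deriv]
    have e1 : (1 - x) ^ κ = (1 - x) ^ (κ - 1) * (1 - x) := by
      rw [← Real.rpow_add_one hx1.ne']
      congr 1
      ring
    have e2 : (1 - x) ^ (κ - 1 - 1) = (1 - x) ^ (κ - 1) / (1 - x) :=
      Real.rpow_sub_one hx1.ne' _
    rw [e1, e2]
    have e3 := hbound x hx
    have e4 : H / (1 - x) ≤ K * (1 - κ) / (1 - x) := by gcongr
    have e5 : 0 ≤ (1 - x) ^ (κ - 1) := Real.rpow_nonneg hx1.le _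
    have e6 : (1 - x) * p' x - κ * p x - K * (1 - κ) / (1 - x) ≤ 0 := by linarith
    calc _ = (1 - x) ^ (κ - 1) * ((1 - x) * p' x - κ * p x - K * (1 - κ) / (1 - x)) := by ring
      _ ≤ 0 := mul_nonpos_of_nonneg_of_nonpos e5 e6
  have hx1 : 0 < 1 - x₀ := by linarith [hx₀.2]
  have hfin := hanti ⟨le_rfl, hx₀.1⟩ ⟨hx₀.1, le_rfl⟩ hx₀.1
  have hΦ0 : Φ 0 = y 0 - K := by
    simp [hΦ, hp, Finset.sum_range_succ']
  rw [hΦ0] at hfin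
  have e1 : (1 - x₀) ^ κ * p x₀ ≤ y 0 + K * (1 - x₀) ^ (κ - 1) := by
    have : Φ x₀ = (1 - x₀) ^ κ * p x₀ - K * (1 - x₀) ^ (κ - 1) := rfl
    linarith
  have e2 : (1 - x₀) ^ (1 - κ) * (1 - x₀) ^ κ = 1 - x₀ := by
    rw [← Real.rpow_add hx1]
    simp
  have e3 : (1 - x₀) ^ (1 - κ) * (1 - x₀) ^ (κ - 1) = 1 := by
    rw [← Real.rpow_add hx1]
    simp
  calc (1 - x₀) * p x₀ = (1 - x₀) ^ (1 - κ) * ((1 - x₀) ^ κ * p x₀) := by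
        rw [← mul_assoc, e2]
    _ ≤ (1 - x₀) ^ (1 - κ) * (y 0 + K * (1 - x₀) ^ (κ - 1)) := by
        gcongr
    _ = y 0 * (1 - x₀) ^ (1 - κ) + K * ((1 - x₀) ^ (1 - κ) * (1 - x₀) ^ (κ - 1)) := by ring
    _ = _ := by rw [e3, mul_one]

/-- The same estimate for extended non-negative sequences, weighted as in the Wild sum. -/
lemma tsum_wild_weight_mul_le {y : ℕ → ℝ≥0∞} {h : ℕ → ℝ} {κ : ℝ≥0∞} {H K t : ℝ} (hκ : κ ≠ ∞)
    (hy0 : y 0 ≠ ∞) (hh0 : ∀ n, 0 ≤ h n) (hK : 0 ≤ K) (hHK : H ≤ K * (1 - κ.toReal))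
    (hrec : ∀ n : ℕ, ((n : ℝ≥0∞) + 1) * y (n + 1) ≤
      κ * ∑ j ∈ Finset.range (n + 1), y j + ENNReal.ofReal (h n)) (ht : 0 ≤ t)
    (hh : ∀ x ∈ Icc 0 (1 - Real.exp (-t)), ∀ N,
      ∑ n ∈ Finset.range N, h n * x ^ n ≤ H / (1 - x) ^ 2) :
    ∑' n : ℕ, ENNReal.ofReal (Real.exp (-t) * (1 - Real.exp (-t)) ^ n) * y n ≤
      y 0 * ENNReal.ofReal (Real.exp (-(t * (1 - κ.toReal)))) + ENNReal.ofReal K := by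
  have hfin : ∀ n, y n ≠ ∞ := by
    intro n
    induction n using Nat.strong_induction_on with
    | _ n ih =>
      cases n with
      | zero => exact hy0
      | succ n =>
        intro htop
        have h1 := hrec n
        rw [htop, ENNReal.mul_top (by simp), top_le_iff, ENNReal.add_eq_top] at h1
        rcases h1 with h1 | h1
        · refine ENNReal.mul_ne_top hκ ?_ h1
          rw [ENNReal.sum_ne_top]
          intro j hj
          exact ih j (Finset.mem_range.1 hj)
        · exact ENNReal.ofReal_ne_top h1
  have hrec' : ∀ n : ℕ, ((n : ℝ) + 1) * (y (n + 1)).toReal ≤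
      κ.toReal * ∑ j ∈ Finset.range (n + 1), (y j).toReal + h n := by
    intro n
    have hs : ∑ j ∈ Finset.range (n + 1), y j ≠ ∞ := ENNReal.sum_ne_top.2 fun j _ => hfin j
    have h1 := ENNReal.toReal_mono (ENNReal.add_ne_top.2
      ⟨ENNReal.mul_ne_top hκ hs, ENNReal.ofReal_ne_top⟩) (hrec n)
    rwa [ENNReal.toReal_mul, ENNReal.toReal_add (ENNReal.mul_ne_top hκ hs) ENNReal.ofReal_ne_top,
      ENNReal.toReal_mul, ENNReal.toReal_sum (fun j _ => hfin j), ENNReal.toReal_ofReal (hh0 n),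
      ENNReal.toReal_add (ENNReal.natCast_ne_top n) (by simp), ENNReal.toReal_natCast,
      ENNReal.toReal_one] at h1
  have hx := one_sub_exp_neg_mem ht
  have key := one_sub_mul_sum_le_of_recursion (fun n => ENNReal.toReal_nonneg)
    ENNReal.toReal_nonneg hK hHK hrec' hx hh
  rw [sub_sub_cancel, ← Real.exp_mul, neg_mul] at key
  refine ENNReal.tsum_le_of_sum_range_le fun N => ?_
  have hterm : ∀ n, ENNReal.ofReal (Real.exp (-t) * (1 - Real.exp (-t)) ^ n) * y n =
      ENNReal.ofReal (Real.exp (-t) * ((y n).toReal * (1 - Real.exp (-t)) ^ n)) := by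
    intro n
    conv_lhs => rw [← ENNReal.ofReal_toReal (hfin n)]
    rw [← ENNReal.ofReal_mul (wild_weight_nonneg ht n)]
    congr 1
    ring
  have hnn : ∀ n, 0 ≤ Real.exp (-t) * ((y n).toReal * (1 - Real.exp (-t)) ^ n) := fun n =>
    mul_nonneg (Real.exp_pos _).le (mul_nonneg ENNReal.toReal_nonneg (pow_nonneg hx.1 _))
  calc _ ≤ ∑ n ∈ Finset.range (N + 1),
        ENNReal.ofReal (Real.exp (-t) * (1 - Real.exp (-t)) ^ n) * y n :=
        Finset.sum_le_sum_of_subset (Finset.range_mono (Nat.le_succ N))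
    _ = ENNReal.ofReal (Real.exp (-t) *
        ∑ n ∈ Finset.range (N + 1), (y n).toReal * (1 - Real.exp (-t)) ^ n) := by
        rw [Finset.mul_sum, ENNReal.ofReal_sum_of_nonneg fun n _ => hnn n]
        exact Finset.sum_congr rfl fun n _ => hterm n
    _ ≤ ENNReal.ofReal ((y 0).toReal * Real.exp (-(t * (1 - κ.toReal))) + K) :=
        ENNReal.ofReal_le_ofReal (key N)
    _ = _ := by
        rw [ENNReal.ofReal_add (by positivity) hK, ENNReal.ofReal_mul ENNReal.toReal_nonneg,
          ENNReal.ofReal_toReal hy0]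

end Recursion

/-! ### Moment bounds for a single collision -/

section Pointwise

lemma abs_add_rpow_le {γ : ℝ} (h0 : 0 < γ) (h1 : γ ≤ 1) (a b : ℝ) :
    |a + b| ^ γ ≤ |a| ^ γ + |b| ^ γ :=
  (Real.rpow_le_rpow (abs_nonneg _) (abs_add_le a b) h0.le).trans
    (Real.rpow_add_le_add_rpow (abs_nonneg a) (abs_nonneg b) h0.le h1)

/-- A form of Clarkson's inequality. It follows from the parallelogram identity by concavity and
subadditivity of `x ↦ x ^ (γ / 2)`. -/
lemma abs_add_rpow_add_abs_sub_rpow_le {γ : ℝ} (h0 : 0 < γ) (h2 : γ ≤ 2) (a b : ℝ) :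
    |a + b| ^ γ + |a - b| ^ γ ≤ 2 * (|a| ^ γ + |b| ^ γ) := by
  have hsq : ∀ x : ℝ, |x| ^ γ = (x ^ 2) ^ (γ / 2) := by
    intro x
    rw [← sq_abs, ← Real.rpow_natCast, ← Real.rpow_mul (abs_nonneg x)]
    congr 1
    push_cast
    ring
  have hconc := (Real.concaveOn_rpow (p := γ / 2) (by linarith) (by linarith)).2
    (mem_Ici.2 (sq_nonneg (a + b))) (mem_Ici.2 (sq_nonneg (a - b)))
    (by norm_num : (0 : ℝ) ≤ 1 / 2) (by norm_num : (0 : ℝ) ≤ 1 / 2) (by norm_num)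
  have hsub := Real.rpow_add_le_add_rpow (sq_nonneg a) (sq_nonneg b)
    (by linarith : 0 ≤ γ / 2) (by linarith)
  have e : (1 / 2 : ℝ) • (a + b) ^ 2 + (1 / 2 : ℝ) • (a - b) ^ 2 = a ^ 2 + b ^ 2 := by
    simp only [smul_eq_mul]
    ring
  rw [e] at hconc
  simp only [smul_eq_mul] at hconc
  rw [hsq, hsq, hsq a, hsq b]
  linarith

/-- For `1 ≤ γ ≤ 2` the `γ`-th power is additive up to a cross term, which for any reference scale
`G` is bounded by a product of functions of the first order. -/
lemma abs_add_rpow_le_add_cross {γ G l r : ℝ} (h1 : 1 ≤ γ) (h2 : γ ≤ 2) (hG : 0 < G) (hl : 0 ≤ l)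
    (hr : 0 ≤ r) (x y : ℝ) :
    |l * x + r * y| ^ γ ≤ l ^ γ * |x| ^ γ + r ^ γ * |y| ^ γ
      + (l ^ γ + r ^ γ) * (2 * G ^ (γ - 2)) * ((G + |x|) * (G + |y|)) := by
  have hsplit : ∀ a : ℝ, 0 ≤ a → a ^ γ = a * a ^ (γ - 1) := by
    intro a ha
    rcases ha.eq_or_lt with rfl | ha
    · rw [zero_mul, Real.zero_rpow (by linarith)]
    · rw [← Real.rpow_one_add' ha.le (by linarith)]
      congr 1
      ring
  have hmix : ∀ a b : ℝ, 0 ≤ a → 0 ≤ b → a * b ^ (γ - 1) ≤ a ^ γ + b ^ γ := by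
    intro a b ha hb
    have hγ1 : 0 ≤ γ - 1 := by linarith
    rcases le_total a b with hab | hab
    · have := mul_le_mul_of_nonneg_right hab (Real.rpow_nonneg hb (γ - 1))
      rw [← hsplit b hb] at this
      linarith [Real.rpow_nonneg ha γ]
    · have := mul_le_mul_of_nonneg_left (Real.rpow_le_rpow hb hab hγ1) ha
      rw [← hsplit a ha] at this
      linarith [Real.rpow_nonneg hb γ]
  have hscale : ∀ a b : ℝ, 0 ≤ a → 0 ≤ b →
      a * b ^ (γ - 1) ≤ G ^ (γ - 2) * ((G + a) * (G + b)) := by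
    intro a b ha hb
    have hGpos : 0 < G ^ (γ - 2) := Real.rpow_pos_of_pos hG _
    have hGb : b ^ (γ - 1) ≤ (G + b) ^ (γ - 1) :=
      Real.rpow_le_rpow hb (by linarith) (by linarith)
    have hsp : (G + b) ^ (γ - 1) = (G + b) ^ (γ - 2) * (G + b) := by
      rw [← Real.rpow_add_one (by positivity)]
      congr 1
      ring
    have hmono : (G + b) ^ (γ - 2) ≤ G ^ (γ - 2) :=
      Real.rpow_le_rpow_of_nonpos hG (by linarith) (by linarith)
    calc a * b ^ (γ - 1) ≤ (G + a) * (G ^ (γ - 2) * (G + b)) := by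
          refine mul_le_mul (by linarith) ?_ (Real.rpow_nonneg hb _) (by positivity)
          rw [hsp] at hGb
          exact hGb.trans (by gcongr)
      _ = _ := by ring
  have hmain : ∀ a b : ℝ, 0 ≤ a → 0 ≤ b →
      (a + b) ^ γ ≤ a ^ γ + b ^ γ + a * b ^ (γ - 1) + b * a ^ (γ - 1) := by
    intro a b ha hb
    rw [hsplit _ (add_nonneg ha hb), hsplit a ha, hsplit b hb]
    have := Real.rpow_add_le_add_rpow ha hb (by linarith : 0 ≤ γ - 1) (by linarith)
    calc (a + b) * (a + b) ^ (γ - 1) ≤ (a + b) * (a ^ (γ - 1) + b ^ (γ - 1)) := by gcongr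
      _ = _ := by ring
  have hx := abs_nonneg x
  have hy := abs_nonneg y
  have e1 : |l * x + r * y| ≤ l * |x| + r * |y| := by
    refine (abs_add_le _ _).trans_eq ?_
    rw [abs_mul, abs_mul, abs_of_nonneg hl, abs_of_nonneg hr]
  have e2 := hmain (l * |x|) (r * |y|) (by positivity) (by positivity)
  rw [Real.mul_rpow hl hx, Real.mul_rpow hr hy, Real.mul_rpow hl hx, Real.mul_rpow hr hy] at e2
  have e3 : l * |x| * (r ^ (γ - 1) * |y| ^ (γ - 1)) ≤
      (l ^ γ + r ^ γ) * (G ^ (γ - 2) * ((G + |x|) * (G + |y|))) := by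
    calc _ = (l * r ^ (γ - 1)) * (|x| * |y| ^ (γ - 1)) := by ring
      _ ≤ _ := mul_le_mul (hmix l r hl hr) (hscale _ _ hx hy) (by positivity) (by positivity)
  have e4 : r * |y| * (l ^ (γ - 1) * |x| ^ (γ - 1)) ≤
      (l ^ γ + r ^ γ) * (G ^ (γ - 2) * ((G + |x|) * (G + |y|))) := by
    calc _ = (r * l ^ (γ - 1)) * (|y| * |x| ^ (γ - 1)) := by ring
      _ ≤ (r ^ γ + l ^ γ) * (G ^ (γ - 2) * ((G + |y|) * (G + |x|))) :=
        mul_le_mul (hmix r l hr hl) (hscale _ _ hy hx) (by positivity) (by positivity)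
      _ = _ := by ring
  have e5 := Real.rpow_le_rpow (abs_nonneg _) e1 (by linarith : 0 ≤ γ)
  calc _ ≤ _ := e5
    _ ≤ _ := e2
    _ ≤ _ := by linarith

end Pointwise

section Moments

variable {Ω : Type*} [MeasurableSpace Ω] {P : Measure Ω} {L R : Ω → ℝ}

/-- The absolute moment of order `s` of a law on the real line, as an extended real. -/
noncomputable def absMoment (s : ℝ) (μ : Measure ℝ) : ℝ≥0∞ :=
  ∫⁻ x, ENNReal.ofReal (|x| ^ s) ∂μ

lemma measurable_ofReal_abs_rpow (s : ℝ) : Measurable fun x : ℝ => ENNReal.ofReal (|x| ^ s) := by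
  fun_prop

lemma powerMoment_eq_add (hL : Measurable L) (hL0 : ∀ᵐ ω ∂P, 0 ≤ L ω) (hR0 : ∀ᵐ ω ∂P, 0 ≤ R ω)
    (s : ℝ) : powerMoment P L R s =
      ∫⁻ ω, ENNReal.ofReal (L ω ^ s) ∂P + ∫⁻ ω, ENNReal.ofReal (R ω ^ s) ∂P := by
  rw [← lintegral_add_left (by fun_prop), powerMoment]
  refine lintegral_congr_ae ?_
  filter_upwards [hL0, hR0] with ω h1 h2
  rw [ENNReal.ofReal_add (Real.rpow_nonneg h1 _) (Real.rpow_nonneg h2 _)]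

/-- A pointwise bound for the outcome of a collision, additive in the states before the collision up
to a product term, passes to the laws. -/
lemma lintegral_collision_le [IsProbabilityMeasure P] {μ ν : Measure ℝ} [IsProbabilityMeasure μ]
    [IsProbabilityMeasure ν] {a b c : Ω → ℝ≥0∞} {f g : ℝ → ℝ≥0∞} {F : Ω × ℝ × ℝ → ℝ≥0∞}
    (ha : Measurable a) (hb : Measurable b) (hc : Measurable c) (hf : Measurable f)
    (hg : Measurable g)
    (hF : ∀ᵐ p ∂(P.prod (μ.prod ν)), F p ≤
      a p.1 * f p.2.1 + b p.1 * f p.2.2 + c p.1 * (g p.2.1 * g p.2.2)) :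
    ∫⁻ p, F p ∂(P.prod (μ.prod ν)) ≤ (∫⁻ ω, a ω ∂P) * ∫⁻ x, f x ∂μ
      + (∫⁻ ω, b ω ∂P) * ∫⁻ x, f x ∂ν
      + (∫⁻ ω, c ω ∂P) * ((∫⁻ x, g x ∂μ) * ∫⁻ x, g x ∂ν) := by
  refine (lintegral_mono_ae hF).trans_eq ?_
  rw [lintegral_add_left (by fun_prop), lintegral_add_left (by fun_prop)]
  congr 1
  · congr 1
    · rw [lintegral_prod_mul (f := a) (g := fun z : ℝ × ℝ => f z.1) ha.aemeasurable
        (by fun_prop)]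
      congr 1
      have := lintegral_prod_mul (μ := μ) (ν := ν) (f := f) (g := fun _ => 1) hf.aemeasurable
        (by fun_prop)
      simpa using this
    · rw [lintegral_prod_mul (f := b) (g := fun z : ℝ × ℝ => f z.2) hb.aemeasurable
        (by fun_prop)]
      congr 1
      have := lintegral_prod_mul (μ := μ) (ν := ν) (f := fun _ => 1) (g := f)
        (by fun_prop) hf.aemeasurable
      simpa using this
  · rw [lintegral_prod_mul (f := c) (g := fun z : ℝ × ℝ => g z.1 * g z.2) hc.aemeasurable
        (by fun_prop), lintegral_prod_mul hg.aemeasurable hg.aemeasurable]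

lemma ae_nonneg_fst {E : Type*} [MeasurableSpace E] {ρ : Measure E} [SFinite ρ]
    (hL0 : ∀ᵐ ω ∂P, 0 ≤ L ω) : ∀ᵐ p ∂(P.prod ρ), 0 ≤ L p.1 :=
  Measure.quasiMeasurePreserving_fst.ae hL0

lemma ofReal_abs_mul_rpow {l x s : ℝ} (hl : 0 ≤ l) :
    ENNReal.ofReal (|l * x| ^ s) = ENNReal.ofReal (l ^ s) * ENNReal.ofReal (|x| ^ s) := by
  rw [abs_mul, abs_of_nonneg hl, Real.mul_rpow hl (abs_nonneg x),
    ENNReal.ofReal_mul (Real.rpow_nonneg hl _)]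

lemma absMoment_collide_le_of_le_one [IsProbabilityMeasure P] (hL : Measurable L)
    (hR : Measurable R) (hL0 : ∀ᵐ ω ∂P, 0 ≤ L ω) (hR0 : ∀ᵐ ω ∂P, 0 ≤ R ω) {γ : ℝ} (h0 : 0 < γ)
    (h1 : γ ≤ 1) (μ ν : Measure ℝ) [IsProbabilityMeasure μ] [IsProbabilityMeasure ν] :
    absMoment γ (collide P L R μ ν) ≤ (∫⁻ ω, ENNReal.ofReal (L ω ^ γ) ∂P) * absMoment γ μ
      + (∫⁻ ω, ENNReal.ofReal (R ω ^ γ) ∂P) * absMoment γ ν := by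
  have hmL : Measurable fun ω => ENNReal.ofReal (L ω ^ γ) := by fun_prop
  have hmR : Measurable fun ω => ENNReal.ofReal (R ω ^ γ) := by fun_prop
  rw [absMoment, lintegral_collide hL hR μ ν (measurable_ofReal_abs_rpow γ)]
  refine (lintegral_collision_le (c := 0) (g := 0) hmL hmR measurable_const
    (measurable_ofReal_abs_rpow γ) measurable_const ?_).trans_eq (by simp [absMoment])
  filter_upwards [ae_nonneg_fst hL0, ae_nonneg_fst hR0] with p hp1 hp2
  simp only [smul_eq_mul, Pi.zero_apply, mul_zero, add_zero]
  rw [← ofReal_abs_mul_rpow hp1, ← ofReal_abs_mul_rpow hp2,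
    ← ENNReal.ofReal_add (by positivity) (by positivity)]
  exact ENNReal.ofReal_le_ofReal (abs_add_rpow_le h0 h1 _ _)

/-- The `γ`-th absolute moment with `γ ≤ 2` is subadditive under collisions if one of the two laws
is symmetric: average Clarkson's inequality over the sign of the corresponding state. -/
lemma absMoment_collide_le_of_symmetric [IsProbabilityMeasure P] (hL : Measurable L)
    (hR : Measurable R) (hL0 : ∀ᵐ ω ∂P, 0 ≤ L ω) (hR0 : ∀ᵐ ω ∂P, 0 ≤ R ω) {γ : ℝ} (h0 : 0 < γ)
    (h2 : γ ≤ 2) (μ ν : Measure ℝ) [IsProbabilityMeasure μ] [IsProbabilityMeasure ν]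
    (hν : ν.map (fun x => -x) = ν) :
    absMoment γ (collide P L R μ ν) ≤ (∫⁻ ω, ENNReal.ofReal (L ω ^ γ) ∂P) * absMoment γ μ
      + (∫⁻ ω, ENNReal.ofReal (R ω ^ γ) ∂P) * absMoment γ ν := by
  have hmL : Measurable fun ω => ENNReal.ofReal (L ω ^ γ) := by fun_prop
  have hmR : Measurable fun ω => ENNReal.ofReal (R ω ^ γ) := by fun_prop
  set ρ := P.prod (μ.prod ν) with hρ
  have hneg : ρ.map (fun p => (p.1, (p.2.1, -p.2.2))) = ρ := by
    have e : (fun p : Ω × ℝ × ℝ => (p.1, (p.2.1, -p.2.2))) =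
        Prod.map id (Prod.map id (fun x => -x)) := rfl
    rw [e, hρ, ← Measure.map_prod_map P (μ.prod ν) measurable_id (by fun_prop),
      ← Measure.map_prod_map μ ν measurable_id (by fun_prop), Measure.map_id, Measure.map_id, hν]
  have hplus : absMoment γ (collide P L R μ ν) =
      ∫⁻ p, ENNReal.ofReal (|L p.1 * p.2.1 + R p.1 * p.2.2| ^ γ) ∂ρ := by
    rw [absMoment, lintegral_collide hL hR μ ν (measurable_ofReal_abs_rpow γ)]
    simp only [smul_eq_mul, hρ]
  have hminus : absMoment γ (collide P L R μ ν) =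
      ∫⁻ p, ENNReal.ofReal (|L p.1 * p.2.1 - R p.1 * p.2.2| ^ γ) ∂ρ := by
    rw [hplus]
    conv_lhs => rw [← hneg]
    rw [lintegral_map (by fun_prop) (by fun_prop)]
    simp only [mul_neg, ← sub_eq_add_neg]
  have hle : ∫⁻ p, (2⁻¹ * (ENNReal.ofReal (|L p.1 * p.2.1 + R p.1 * p.2.2| ^ γ) +
      ENNReal.ofReal (|L p.1 * p.2.1 - R p.1 * p.2.2| ^ γ))) ∂ρ ≤
      (∫⁻ ω, ENNReal.ofReal (L ω ^ γ) ∂P) * absMoment γ μ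
      + (∫⁻ ω, ENNReal.ofReal (R ω ^ γ) ∂P) * absMoment γ ν := by
    refine (lintegral_collision_le (c := 0) (g := 0) hmL hmR measurable_const
      (measurable_ofReal_abs_rpow γ) measurable_const ?_).trans_eq (by simp [absMoment])
    filter_upwards [ae_nonneg_fst hL0, ae_nonneg_fst hR0] with p hp1 hp2
    simp only [Pi.zero_apply, mul_zero, add_zero]
    rw [← ofReal_abs_mul_rpow hp1, ← ofReal_abs_mul_rpow hp2,
      ← ENNReal.ofReal_add (by positivity) (by positivity),
      ← ENNReal.ofReal_add (by positivity) (by positivity), ← ENNReal.div_eq_inv_mul]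
    refine ENNReal.div_le_of_le_mul ?_
    refine (ENNReal.ofReal_le_ofReal
      (abs_add_rpow_add_abs_sub_rpow_le h0 h2 _ _)).trans_eq ?_
    rw [ENNReal.ofReal_mul zero_le_two, ENNReal.ofReal_ofNat, mul_comm]
  rw [lintegral_const_mul _ (by fun_prop), lintegral_add_left (by fun_prop), ← hplus, ← hminus,
    ← two_mul, ← mul_assoc, ENNReal.inv_mul_cancel (by simp) (by simp), one_mul] at hle
  exact hle

lemma sum_range_recursion (a b : ℝ≥0∞) (y : ℕ → ℝ≥0∞) (n : ℕ) :
    ∑ i ∈ Finset.range (n + 1), (a * y i + b * y (n - i)) =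
      (a + b) * ∑ i ∈ Finset.range (n + 1), y i := by
  rw [Finset.sum_add_distrib, ← Finset.mul_sum, ← Finset.mul_sum, add_mul]
  congr 2
  have := Finset.sum_range_reflect y (n + 1)
  simpa using this

/-- If the `γ`-th moment is subadditive along the collisions, then it decays exponentially with rate
`1 - E[L ^ γ + R ^ γ]` along the evolution. -/
lemma absMoment_wildSum_le (hL : Measurable L) (hL0 : ∀ᵐ ω ∂P, 0 ≤ L ω) (hR0 : ∀ᵐ ω ∂P, 0 ≤ R ω)
    {s : ℝ} {μ : Measure ℝ} (hκ : powerMoment P L R s ≠ ∞) (hμ : absMoment s μ ≠ ∞)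
    (hsub : ∀ i j, absMoment s (collide P L R (wild P L R μ i) (wild P L R μ j)) ≤
      (∫⁻ ω, ENNReal.ofReal (L ω ^ s) ∂P) * absMoment s (wild P L R μ i)
      + (∫⁻ ω, ENNReal.ofReal (R ω ^ s) ∂P) * absMoment s (wild P L R μ j))
    {t : ℝ} (ht : 0 ≤ t) :
    absMoment s (wildSum P L R μ t) ≤
      absMoment s μ * ENNReal.ofReal (Real.exp (-(t * (1 - (powerMoment P L R s).toReal)))) := by
  have key := tsum_wild_weight_mul_le (y := fun n => absMoment s (wild P L R μ n)) (h := 0)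
    (H := 0) (K := 0) hκ (by simpa) (fun _ => le_rfl) le_rfl (by simp) ?_ ht (by simp)
  · simpa [absMoment, lintegral_wildSum] using key
  · intro n
    simp only [Pi.zero_apply, ENNReal.ofReal_zero, add_zero]
    rw [absMoment, lintegral_wild_succ, powerMoment_eq_add hL hL0 hR0, ← sum_range_recursion]
    exact Finset.sum_le_sum fun i _ => hsub i (n - i)

end Moments

/-! ### Symmetrization -/

section Symmetrization

/-- The kernel whose integral over `s > 0` represents `|x| ^ γ` up to a constant factor. -/
noncomputable def cosKernel (γ x s : ℝ) : ℝ := (1 - Real.cos (x * s)) * s ^ (-1 - γ)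

lemma cosKernel_nonneg (γ x : ℝ) {s : ℝ} (hs : 0 < s) : 0 ≤ cosKernel γ x s :=
  mul_nonneg (sub_nonneg.2 (Real.cos_le_one _)) (Real.rpow_nonneg hs.le _)

lemma integrableOn_cosKernel {γ : ℝ} (h0 : 0 < γ) (h2 : γ < 2) (x : ℝ) :
    IntegrableOn (cosKernel γ x) (Ioi 0) := by
  have hm : Measurable (cosKernel γ x) := by
    unfold cosKernel
    fun_prop
  rw [← Ioc_union_Ioi_eq_Ioi (zero_le_one' ℝ)]
  refine IntegrableOn.union ?_ ?_
  · have h : IntegrableOn (fun s : ℝ => x ^ 2 / 2 * s ^ (1 - γ)) (Ioc 0 1) := by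
      have := (intervalIntegral.intervalIntegrable_rpow' (a := 0) (b := 1)
        (by linarith : -1 < 1 - γ)).const_mul (x ^ 2 / 2)
      rwa [intervalIntegrable_iff_integrableOn_Ioc_of_le zero_le_one] at this
    refine Integrable.mono' h hm.aestronglyMeasurable ?_
    refine (ae_restrict_iff' measurableSet_Ioc).2 (ae_of_all _ fun s hs => ?_)
    rw [Real.norm_of_nonneg (cosKernel_nonneg γ x hs.1), cosKernel]
    have e : s ^ (1 - γ) = s ^ 2 * s ^ (-1 - γ) := by
      rw [← Real.rpow_natCast, ← Real.rpow_add hs.1]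
      congr 1
      push_cast
      ring
    rw [e, ← mul_assoc]
    refine mul_le_mul_of_nonneg_right ?_ (Real.rpow_nonneg hs.1.le _)
    have := Real.one_sub_sq_div_two_le_cos (x := x * s)
    calc 1 - Real.cos (x * s) ≤ (x * s) ^ 2 / 2 := by linarith
      _ = _ := by ring
  · have h : IntegrableOn (fun s : ℝ => 2 * s ^ (-1 - γ)) (Ioi 1) :=
      (integrableOn_Ioi_rpow_of_lt (by linarith) one_pos).const_mul 2
    refine Integrable.mono' h hm.aestronglyMeasurable ?_
    refine (ae_restrict_iff' measurableSet_Ioi).2 (ae_of_all _ fun s hs => ?_)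
    have hs0 : 0 < s := one_pos.trans hs
    rw [Real.norm_of_nonneg (cosKernel_nonneg γ x hs0), cosKernel]
    refine mul_le_mul_of_nonneg_right ?_ (Real.rpow_nonneg hs0.le _)
    linarith [Real.neg_one_le_cos (x * s)]

lemma integral_cosKernel {γ : ℝ} (h0 : 0 < γ) (x : ℝ) :
    ∫ s in Ioi 0, cosKernel γ x s = |x| ^ γ * ∫ s in Ioi 0, cosKernel γ 1 s := by
  have habs : cosKernel γ x = cosKernel γ |x| := by
    ext s
    unfold cosKernel
    rcases abs_choice x with h | h
    · rw [h]
    · rw [h, neg_mul, Real.cos_neg]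
  rw [habs]
  rcases (abs_nonneg x).eq_or_lt with hx | hx
  · rw [← hx, Real.zero_rpow h0.ne']
    simp [cosKernel]
  · have h := integral_comp_mul_left_Ioi (cosKernel γ 1) 0 hx
    rw [mul_zero, smul_eq_mul] at h
    have e : ∀ s ∈ Ioi (0 : ℝ), cosKernel γ |x| s = |x| ^ (1 + γ) * cosKernel γ 1 (|x| * s) := by
      intro s hs
      have hs : 0 < s := hs
      unfold cosKernel
      rw [one_mul, Real.mul_rpow hx.le hs.le]
      have : |x| ^ (1 + γ) * |x| ^ (-1 - γ) = 1 := by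
        rw [← Real.rpow_add hx]
        simp
      linear_combination (-(1 - Real.cos (|x| * s)) * s ^ (-1 - γ)) * this
    rw [setIntegral_congr_fun measurableSet_Ioi e, integral_const_mul, h, ← mul_assoc]
    congr 1
    rw [Real.rpow_add hx, Real.rpow_one]
    field_simp

lemma integral_cosKernel_one_pos {γ : ℝ} (h0 : 0 < γ) (h2 : γ < 2) :
    0 < ∫ s in Ioi 0, cosKernel γ 1 s := by
  rw [setIntegral_pos_iff_support_of_nonneg_ae
    ((ae_restrict_iff' measurableSet_Ioi).2 (ae_of_all _ fun s hs => cosKernel_nonneg γ 1 hs))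
    (integrableOn_cosKernel h0 h2 1)]
  have hsub : Ioo (0 : ℝ) 1 ⊆ Function.support (cosKernel γ 1) ∩ Ioi 0 := by
    intro s hs
    refine ⟨?_, hs.1⟩
    have hcos : Real.cos s < 1 := by
      have := Real.cos_lt_cos_of_nonneg_of_le_pi le_rfl
        (by linarith [hs.2, Real.pi_gt_three] : s ≤ Real.pi) hs.1
      rwa [Real.cos_zero] at this
    rw [Function.mem_support, cosKernel, one_mul]
    exact (mul_pos (sub_pos.2 hcos) (Real.rpow_pos_of_pos hs.1 _)).ne'
  exact lt_of_lt_of_le (by simp) (measure_mono hsub)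

lemma lintegral_cosKernel {γ : ℝ} (h0 : 0 < γ) (h2 : γ < 2) (x : ℝ) :
    ∫⁻ s in Ioi 0, ENNReal.ofReal (cosKernel γ x s) =
      ENNReal.ofReal (∫ s in Ioi 0, cosKernel γ 1 s) * ENNReal.ofReal (|x| ^ γ) := by
  rw [← ofReal_integral_eq_lintegral_ofReal (integrableOn_cosKernel h0 h2 x)
    ((ae_restrict_iff' measurableSet_Ioi).2 (ae_of_all _ fun s hs => cosKernel_nonneg γ x hs)),
    integral_cosKernel h0, mul_comm, ENNReal.ofReal_mul (integral_cosKernel_one_pos h0 h2).le]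

/-- In terms of the characteristic function `f`: `1 - |f| ^ 2 ≤ 2 (1 - Re f)`. -/
lemma integral_one_sub_cos_sub_le (μ : Measure ℝ) [IsProbabilityMeasure μ] (s : ℝ) :
    ∫ z : ℝ × ℝ, (1 - Real.cos ((z.1 - z.2) * s)) ∂(μ.prod μ) ≤
      2 * ∫ x, (1 - Real.cos (x * s)) ∂μ := by
  have hc : Integrable (fun x => Real.cos (x * s)) μ :=
    Integrable.of_bound (C := 1) (Measurable.aestronglyMeasurable (by fun_prop))
      (ae_of_all _ fun x => Real.abs_cos_le_one _)
  have hs : Integrable (fun x => Real.sin (x * s)) μ :=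
    Integrable.of_bound (C := 1) (Measurable.aestronglyMeasurable (by fun_prop))
      (ae_of_all _ fun x => Real.abs_sin_le_one _)
  have e : ∀ z : ℝ × ℝ, 1 - Real.cos ((z.1 - z.2) * s) = 1 -
      (Real.cos (z.1 * s) * Real.cos (z.2 * s) + Real.sin (z.1 * s) * Real.sin (z.2 * s)) := by
    intro z
    rw [sub_mul, Real.cos_sub]
  have hadd : Integrable (fun z : ℝ × ℝ => Real.cos (z.1 * s) * Real.cos (z.2 * s)
      + Real.sin (z.1 * s) * Real.sin (z.2 * s)) (μ.prod μ) :=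
    (hc.mul_prod hc).add (hs.mul_prod hs)
  simp_rw [e]
  rw [integral_sub (integrable_const _) hadd,
    integral_add (hc.mul_prod hc) (hs.mul_prod hs),
    integral_prod_mul (fun x => Real.cos (x * s)) (fun x => Real.cos (x * s)),
    integral_prod_mul (fun x => Real.sin (x * s)) (fun x => Real.sin (x * s)),
    integral_sub (integrable_const _) hc]
  simp only [integral_const, probReal_univ, smul_eq_mul, mul_one]
  nlinarith [sq_nonneg (1 - ∫ x, Real.cos (x * s) ∂μ), sq_nonneg (∫ x, Real.sin (x * s) ∂μ)]

/-- Two independent copies `X`, `X'` of a random variable satisfy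
`E |X - X'| ^ γ ≤ 2 E |X| ^ γ` for `0 < γ < 2`. -/
lemma lintegral_abs_sub_rpow_le_of_lt_two {γ : ℝ} (h0 : 0 < γ) (h2 : γ < 2) (μ : Measure ℝ)
    [IsProbabilityMeasure μ] :
    ∫⁻ z, ENNReal.ofReal (|z.1 - z.2| ^ γ) ∂(μ.prod μ) ≤ 2 * absMoment γ μ := by
  obtain ⟨c, hc⟩ : ∃ c, c = ENNReal.ofReal (∫ s in Ioi 0, cosKernel γ 1 s) := ⟨_, rfl⟩
  have hc0 : c ≠ 0 := by
    rw [hc, Ne, ENNReal.ofReal_eq_zero, not_le]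
    exact integral_cosKernel_one_pos h0 h2
  have hctop : c ≠ ∞ := hc ▸ ENNReal.ofReal_ne_top
  have hrep : ∀ x : ℝ, c * ENNReal.ofReal (|x| ^ γ) =
      ∫⁻ s in Ioi 0, ENNReal.ofReal (cosKernel γ x s) := by
    intro x
    rw [lintegral_cosKernel h0 h2, hc]
  rw [← ENNReal.mul_le_mul_iff_right hc0 hctop]
  have hk1 : Measurable (Function.uncurry fun (z : ℝ × ℝ) (s : ℝ) =>
      ENNReal.ofReal (cosKernel γ (z.1 - z.2) s)) := by
    unfold cosKernel Function.uncurry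
    fun_prop
  have hk2 : Measurable (Function.uncurry fun (x : ℝ) (s : ℝ) =>
      ENNReal.ofReal (cosKernel γ x s)) := by
    unfold cosKernel Function.uncurry
    fun_prop
  have e1 : c * ∫⁻ z, ENNReal.ofReal (|z.1 - z.2| ^ γ) ∂(μ.prod μ) =
      ∫⁻ s in Ioi 0, ∫⁻ z, ENNReal.ofReal (cosKernel γ (z.1 - z.2) s) ∂(μ.prod μ) := by
    rw [← lintegral_const_mul _ (by fun_prop), ← lintegral_lintegral_swap hk1.aemeasurable]
    exact lintegral_congr fun z => hrep _
  have e2 : c * (2 * absMoment γ μ) =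
      ∫⁻ s in Ioi 0, 2 * ∫⁻ x, ENNReal.ofReal (cosKernel γ x s) ∂μ := by
    rw [lintegral_const_mul _ hk2.lintegral_prod_left,
      ← lintegral_lintegral_swap hk2.aemeasurable, mul_left_comm, absMoment,
      ← lintegral_const_mul _ (measurable_ofReal_abs_rpow γ)]
    congr 1
    exact lintegral_congr fun z => hrep _
  rw [e1, e2]
  refine setLIntegral_mono' measurableSet_Ioi fun s hs => ?_
  have hs : 0 < s := hs
  have hsplit : ∀ x, ENNReal.ofReal (cosKernel γ x s) =
      ENNReal.ofReal (1 - Real.cos (x * s)) * ENNReal.ofReal (s ^ (-1 - γ)) := fun x =>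
    ENNReal.ofReal_mul (sub_nonneg.2 (Real.cos_le_one _))
  simp_rw [hsplit]
  rw [lintegral_mul_const _ (by fun_prop), lintegral_mul_const _ (by fun_prop), ← mul_assoc]
  gcongr
  rw [← ofReal_integral_eq_lintegral_ofReal, ← ofReal_integral_eq_lintegral_ofReal,
    ← ENNReal.ofReal_ofNat 2, ← ENNReal.ofReal_mul (by positivity)]
  · exact ENNReal.ofReal_le_ofReal (integral_one_sub_cos_sub_le μ s)
  · exact (integrable_const _).sub (Integrable.of_bound (C := 1)
      (Measurable.aestronglyMeasurable (by fun_prop)) (ae_of_all _ fun x => Real.abs_cos_le_one _))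
  · exact ae_of_all _ fun x => sub_nonneg.2 (Real.cos_le_one _)
  · exact (integrable_const _).sub (Integrable.of_bound (C := 1)
      (Measurable.aestronglyMeasurable (by fun_prop)) (ae_of_all _ fun x => Real.abs_cos_le_one _))
  · exact ae_of_all _ fun x => sub_nonneg.2 (Real.cos_le_one _)

lemma lintegral_abs_sub_sq_le {μ : Measure ℝ} [IsProbabilityMeasure μ]
    (hint : Integrable (fun x => x) μ) (hmean : ∫ x, x ∂μ = 0) :
    ∫⁻ z, ENNReal.ofReal (|z.1 - z.2| ^ (2 : ℝ)) ∂(μ.prod μ) ≤ 2 * absMoment 2 μ := by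
  by_cases htop : absMoment 2 μ = ∞
  · rw [htop, ENNReal.mul_top (by simp)]
    exact le_top
  have hsq : Integrable (fun x => x ^ 2) μ := by
    refine ⟨by fun_prop, ?_⟩
    rw [hasFiniteIntegral_iff_ofReal (ae_of_all _ fun x => sq_nonneg x)]
    simpa [absMoment] using lt_top_iff_ne_top.2 htop
  have h1 : Integrable (fun z : ℝ × ℝ => z.1 ^ 2) (μ.prod μ) := hsq.comp_fst μ
  have h2 : Integrable (fun z : ℝ × ℝ => z.2 ^ 2) (μ.prod μ) := hsq.comp_snd μ
  have h3 : Integrable (fun z : ℝ × ℝ => z.1 * z.2) (μ.prod μ) := hint.mul_prod hint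
  have e : ∀ z : ℝ × ℝ, |z.1 - z.2| ^ (2 : ℝ) = (z.1 ^ 2 + z.2 ^ 2) - 2 * (z.1 * z.2) := by
    intro z
    rw [Real.rpow_two, sq_abs]
    ring
  have h12 : Integrable (fun z : ℝ × ℝ => z.1 ^ 2 + z.2 ^ 2) (μ.prod μ) := h1.add h2
  have hall : Integrable (fun z : ℝ × ℝ => z.1 ^ 2 + z.2 ^ 2 - 2 * (z.1 * z.2)) (μ.prod μ) :=
    h12.sub (h3.const_mul 2)
  simp_rw [e]
  rw [← ofReal_integral_eq_lintegral_ofReal hall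
    (ae_of_all _ fun z => by simp only [← e]; positivity),
    integral_sub h12 (h3.const_mul 2), integral_add h1 h2, integral_const_mul,
    integral_prod_mul (fun x => x) (fun x => x), hmean, absMoment]
  simp only [Real.rpow_two, sq_abs]
  rw [← ofReal_integral_eq_lintegral_ofReal hsq (ae_of_all _ fun x => sq_nonneg x),
    ← ENNReal.ofReal_ofNat 2, ← ENNReal.ofReal_mul (by positivity)]
  refine ENNReal.ofReal_le_ofReal (le_of_eq ?_)
  rw [integral_prod _ h1, integral_prod _ h2]
  simp
  ring

lemma lintegral_abs_sub_rpow_le {γ : ℝ} (h0 : 0 < γ) (h2 : γ ≤ 2) {μ : Measure ℝ}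
    [IsProbabilityMeasure μ] (hint : Integrable (fun x => x) μ) (hmean : ∫ x, x ∂μ = 0) :
    ∫⁻ z, ENNReal.ofReal (|z.1 - z.2| ^ γ) ∂(μ.prod μ) ≤ 2 * absMoment γ μ := by
  rcases h2.eq_or_lt with rfl | h2
  · exact lintegral_abs_sub_sq_le hint hmean
  · exact lintegral_abs_sub_rpow_le_of_lt_two h0 h2 μ

end Symmetrization

/-! ### Moments of Wild sums of centered laws -/

section CondCentered

/-- The law of a pair `(Z₁, Z₂)` such that `Z₂` is integrable and `E[Z₂ | Z₁] = 0`; the latter is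
tested against bounded measurable functions of `Z₁`. -/
def CondCentered (ρ : Measure (ℝ × ℝ)) : Prop :=
  Integrable (fun z => z.2) ρ ∧
    ∀ g : ℝ → ℝ, Measurable g → (∃ C, ∀ x, |g x| ≤ C) → ∫ z, g z.1 * z.2 ∂ρ = 0

lemma CondCentered.integrable_mul {ρ : Measure (ℝ × ℝ)} (h : CondCentered ρ) {g : ℝ → ℝ}
    (hg : Measurable g) (hb : ∃ C, ∀ x, |g x| ≤ C) : Integrable (fun z => g z.1 * z.2) ρ := by
  obtain ⟨C, hC⟩ := hb
  exact h.1.bdd_mul (Measurable.aestronglyMeasurable (by fun_prop)) (ae_of_all _ fun z => hC z.1)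

lemma condCentered_prod {μ : Measure ℝ} [IsProbabilityMeasure μ]
    (hint : Integrable (fun x => x) μ) (hmean : ∫ x, x ∂μ = 0) : CondCentered (μ.prod μ) := by
  refine ⟨hint.comp_snd μ, fun g _ _ => ?_⟩
  rw [integral_prod_mul g (fun x => x), hmean, mul_zero]

variable {Ω : Type*} [MeasurableSpace Ω] {P : Measure Ω} [IsProbabilityMeasure P] {L R : Ω → ℝ}

/-- The property `E[Z₂ | Z₁] = 0` is preserved when both coordinates undergo the same collision. -/
lemma CondCentered.collide (hL : Measurable L) (hR : Measurable R) (hLi : Integrable L P)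
    (hRi : Integrable R P) {ρ₁ ρ₂ : Measure (ℝ × ℝ)} [IsProbabilityMeasure ρ₁]
    [IsProbabilityMeasure ρ₂] (h₁ : CondCentered ρ₁) (h₂ : CondCentered ρ₂) :
    CondCentered (collide P L R ρ₁ ρ₂) := by
  have hm := measurable_collision (E := ℝ × ℝ) hL hR
  have i1 : Integrable (fun p : Ω × (ℝ × ℝ) × (ℝ × ℝ) => L p.1 * p.2.1.2) (P.prod (ρ₁.prod ρ₂)) :=
    hLi.mul_prod (h₁.1.comp_fst ρ₂)
  have i2 : Integrable (fun p : Ω × (ℝ × ℝ) × (ℝ × ℝ) => R p.1 * p.2.2.2) (P.prod (ρ₁.prod ρ₂)) :=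
    hRi.mul_prod (h₂.1.comp_snd ρ₁)
  refine ⟨?_, fun g hg hb => ?_⟩
  · rw [KineticCLT.collide, integrable_map_measure (by fun_prop) hm.aemeasurable]
    exact i1.add i2
  · obtain ⟨C, hC⟩ := hb
    rw [KineticCLT.collide, integral_map hm.aemeasurable
      (Measurable.aestronglyMeasurable (by fun_prop))]
    set G : Ω × (ℝ × ℝ) × (ℝ × ℝ) → ℝ := fun p => g (L p.1 * p.2.1.1 + R p.1 * p.2.2.1) with hG
    have hGm : AEStronglyMeasurable G (P.prod (ρ₁.prod ρ₂)) :=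
      Measurable.aestronglyMeasurable (by fun_prop)
    have j1 := i1.bdd_mul hGm (ae_of_all _ fun p => hC _)
    have j2 := i2.bdd_mul hGm (ae_of_all _ fun p => hC _)
    have e : ∀ p : Ω × (ℝ × ℝ) × (ℝ × ℝ), g (L p.1 • p.2.1 + R p.1 • p.2.2).1
        * (L p.1 • p.2.1 + R p.1 • p.2.2).2 =
        G p * (L p.1 * p.2.1.2) + G p * (R p.1 * p.2.2.2) := by
      intro p
      simp only [hG, Prod.fst_add, Prod.snd_add, Prod.smul_fst, Prod.smul_snd, smul_eq_mul]
      ring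
    simp_rw [e]
    rw [integral_add j1 j2, integral_prod _ j1, integral_prod _ j2]
    have z1 : ∀ᵐ ω ∂P, ∫ q, G (ω, q) * (L ω * q.1.2) ∂(ρ₁.prod ρ₂) = 0 := by
      filter_upwards [j1.prod_right_ae] with ω hω
      rw [integral_prod_symm _ hω]
      refine integral_eq_zero_of_ae (ae_of_all _ fun y => ?_)
      have h := h₁.2 (fun x => g (L ω * x + R ω * y.1)) (by fun_prop) ⟨C, fun x => hC _⟩
      have e2 : ∀ x : ℝ × ℝ, G (ω, (x, y)) * (L ω * x.2) =
          L ω * (g (L ω * x.1 + R ω * y.1) * x.2) := fun x => by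
        simp only [hG]
        ring
      simp only [e2, integral_const_mul, h, mul_zero, Pi.zero_apply]
    have z2 : ∀ᵐ ω ∂P, ∫ q, G (ω, q) * (R ω * q.2.2) ∂(ρ₁.prod ρ₂) = 0 := by
      filter_upwards [j2.prod_right_ae] with ω hω
      rw [integral_prod _ hω]
      refine integral_eq_zero_of_ae (ae_of_all _ fun x => ?_)
      have h := h₂.2 (fun y => g (L ω * x.1 + R ω * y)) (by fun_prop) ⟨C, fun x => hC _⟩
      have e2 : ∀ y : ℝ × ℝ, G (ω, (x, y)) * (R ω * y.2) =
          R ω * (g (L ω * x.1 + R ω * y.1) * y.2) := fun y => by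
        simp only [hG]
        ring
      simp only [e2, integral_const_mul, h, mul_zero, Pi.zero_apply]
    rw [integral_eq_zero_of_ae z1, integral_eq_zero_of_ae z2, add_zero]

lemma CondCentered.wild (hL : Measurable L) (hR : Measurable R) (hLi : Integrable L P)
    (hRi : Integrable R P) {ρ : Measure (ℝ × ℝ)} [IsProbabilityMeasure ρ] (h : CondCentered ρ)
    (n : ℕ) : CondCentered (wild P L R ρ n) := by
  have hprob := fun n => isProbabilityMeasure_wild (P := P) hL hR ρ n
  induction n using Nat.strong_induction_on with
  | _ n ih =>
    cases n with
    | zero => rwa [wild_zero]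
    | succ n =>
      have hc : ∀ i ∈ Finset.range (n + 1), CondCentered
          (KineticCLT.collide P L R (KineticCLT.wild P L R ρ i)
            (KineticCLT.wild P L R ρ (n - i))) := by
        intro i hi
        rw [Finset.mem_range] at hi
        exact (ih i hi).collide hL hR hLi hRi (ih (n - i) (by omega))
      refine ⟨?_, fun g hg hb => ?_⟩
      · rw [wild_succ]
        exact (integrable_finsetSum_measure.2 fun i hi => (hc i hi).1).smul_measure
          (ENNReal.inv_ne_top.2 (by simp))
      · have key := integral_wild_succ (P := P) (L := L) (R := R) ρ n (fun z => g z.1 * z.2)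
          fun i hi => (hc i hi).integrable_mul hg hb
        rw [Finset.sum_eq_zero fun i hi => (hc i hi).2 g hg hb] at key
        exact (smul_eq_zero.1 key).resolve_left (by positivity)

/-- The tangent line inequality for `|x| ^ γ`; the slope at `0` is `0` by the convention for
division. -/
lemma abs_rpow_le_abs_sub_rpow_add {γ : ℝ} (h1 : 1 ≤ γ) (a b : ℝ) :
    |a| ^ γ ≤ |a - b| ^ γ + γ * (|a| ^ γ / a) * b := by
  rcases eq_or_ne a 0 with rfl | ha
  · rw [abs_zero, Real.zero_rpow (by linarith)]
    simp only [div_zero, mul_zero, zero_mul, add_zero]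
    positivity
  · have hpos : 0 < |a| ^ γ := Real.rpow_pos_of_pos (abs_pos.2 ha) _
    have hb : 1 - γ * (b / a) ≤ |1 - b / a| ^ γ := by
      rcases le_total (b / a) 1 with h | h
      · have := one_add_mul_self_le_rpow_one_add (s := -(b / a)) (by linarith) h1
        rw [abs_of_nonneg (by linarith)]
        calc 1 - γ * (b / a) = 1 + γ * -(b / a) := by ring
          _ ≤ (1 + -(b / a)) ^ γ := this
          _ = _ := by rw [← sub_eq_add_neg]
      · have : 1 ≤ γ * (b / a) := one_le_mul_of_one_le_of_one_le h1 h
        have h2 : 0 ≤ |1 - b / a| ^ γ := by positivity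
        linarith
    have e : |a - b| ^ γ = |a| ^ γ * |1 - b / a| ^ γ := by
      rw [← Real.mul_rpow (abs_nonneg _) (abs_nonneg _), ← abs_mul, mul_sub, mul_one,
        mul_div_cancel₀ _ ha]
    rw [e]
    have := mul_le_mul_of_nonneg_left hb hpos.le
    calc |a| ^ γ = |a| ^ γ * (1 - γ * (b / a)) + γ * (|a| ^ γ / a) * b := by field_simp; ring
      _ ≤ _ := by linarith

/-- Conditional Jensen inequality: `E |Z₁| ^ γ ≤ E |Z₁ - Z₂| ^ γ` if `E[Z₂ | Z₁] = 0`. -/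
lemma CondCentered.lintegral_abs_fst_rpow_le {ρ : Measure (ℝ × ℝ)} [IsProbabilityMeasure ρ]
    (h : CondCentered ρ) {γ : ℝ} (h1 : 1 ≤ γ) :
    ∫⁻ z, ENNReal.ofReal (|z.1| ^ γ) ∂ρ ≤ ∫⁻ z, ENNReal.ofReal (|z.1 - z.2| ^ γ) ∂ρ := by
  by_cases htop : ∫⁻ z, ENNReal.ofReal (|z.1 - z.2| ^ γ) ∂ρ = ∞
  · rw [htop]
    exact le_top
  have hH : Integrable (fun z : ℝ × ℝ => |z.1 - z.2| ^ γ) ρ := by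
    refine ⟨Measurable.aestronglyMeasurable (by fun_prop), ?_⟩
    rw [hasFiniteIntegral_iff_ofReal (ae_of_all _ fun z => by positivity)]
    exact lt_top_iff_ne_top.2 htop
  -- Truncating the first coordinate makes the slope of the tangent line bounded.
  set F : ℕ → ℝ → ℝ := fun k => (Icc (-(k : ℝ)) k).indicator fun x => |x| ^ γ with hF
  have hFnn : ∀ k x, 0 ≤ F k x := fun k x => indicator_nonneg (fun _ _ => by positivity) _
  have hFm : ∀ k, Measurable (F k) := fun k =>
    Measurable.indicator (by fun_prop) measurableSet_Icc
  have hle : ∀ k : ℕ, ∫⁻ z, ENNReal.ofReal (F k z.1) ∂ρ ≤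
      ∫⁻ z, ENNReal.ofReal (|z.1 - z.2| ^ γ) ∂ρ := by
    intro k
    set g : ℝ → ℝ := (Icc (-(k : ℝ)) k).indicator fun x => γ * (|x| ^ γ / x) with hg
    have hgm : Measurable g := Measurable.indicator (by fun_prop) measurableSet_Icc
    have hgb : ∀ x, |g x| ≤ γ * (k : ℝ) ^ (γ - 1) := by
      intro x
      simp only [hg, indicator_apply]
      split_ifs with hx
      · rcases eq_or_ne x 0 with rfl | hx0
        · simp only [div_zero, mul_zero, abs_zero]
          positivity
        · have hxk : |x| ≤ k := abs_le.2 hx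
          rw [abs_mul, abs_of_nonneg (by linarith : 0 ≤ γ), abs_div,
            abs_of_nonneg (by positivity : 0 ≤ |x| ^ γ), ← Real.rpow_sub_one (abs_pos.2 hx0).ne']
          gcongr
      · rw [abs_zero]
        positivity
    have hFi : Integrable (fun z : ℝ × ℝ => F k z.1) ρ := by
      refine Integrable.of_bound (C := (k : ℝ) ^ γ)
        ((hFm k).comp measurable_fst).aestronglyMeasurable (ae_of_all _ fun z => ?_)
      rw [Real.norm_of_nonneg (hFnn _ _)]
      simp only [hF, indicator_apply]
      split_ifs with hx
      · have := abs_le.2 hx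
        gcongr
      · positivity
    have hgi := h.integrable_mul hgm ⟨_, hgb⟩
    have hpt : ∀ z : ℝ × ℝ, F k z.1 ≤ |z.1 - z.2| ^ γ + g z.1 * z.2 := by
      intro z
      simp only [hF, hg, indicator_apply]
      split_ifs
      · exact abs_rpow_le_abs_sub_rpow_add h1 _ _
      · rw [zero_mul, add_zero]
        positivity
    have hint := integral_mono hFi (hH.add hgi) hpt
    simp only [Pi.add_apply] at hint
    rw [integral_add hH hgi, h.2 g hgm ⟨_, hgb⟩, add_zero] at hint
    rw [← ofReal_integral_eq_lintegral_ofReal hFi (ae_of_all _ fun z => hFnn _ _),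
      ← ofReal_integral_eq_lintegral_ofReal hH (ae_of_all _ fun z => by positivity)]
    exact ENNReal.ofReal_le_ofReal hint
  have hlim : Tendsto (fun k => ∫⁻ z, ENNReal.ofReal (F k z.1) ∂ρ) atTop
      (𝓝 (∫⁻ z, ENNReal.ofReal (|z.1| ^ γ) ∂ρ)) := by
    refine lintegral_tendsto_of_tendsto_of_monotone
      (fun k => ((hFm k).comp measurable_fst).ennreal_ofReal.aemeasurable)
      (ae_of_all _ fun z => ?_) (ae_of_all _ fun z => ?_)
    · intro k l hkl
      have : (k : ℝ) ≤ l := by exact_mod_cast hkl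
      refine ENNReal.ofReal_le_ofReal (indicator_le_indicator_of_subset
        (Icc_subset_Icc (by linarith) this) (fun _ => by positivity) _)
    · refine tendsto_const_nhds.congr' ?_
      obtain ⟨N, hN⟩ := exists_nat_ge |z.1|
      filter_upwards [eventually_ge_atTop N] with k hk
      have : (N : ℝ) ≤ k := by exact_mod_cast hk
      simp only [hF]
      have hmem : z.1 ∈ Icc (-(k : ℝ)) k := abs_le.1 (hN.trans this)
      rw [indicator_of_mem hmem]
  exact le_of_tendsto' hlim hle

/-- The `γ`-th absolute moment of a symmetric law, `γ ≤ 2`, decays exponentially along the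
evolution. Symmetry is inherited by the Wild convolutions. -/
lemma absMoment_wildSum_le_of_symmetric (hL : Measurable L) (hR : Measurable R)
    (hL0 : ∀ᵐ ω ∂P, 0 ≤ L ω) (hR0 : ∀ᵐ ω ∂P, 0 ≤ R ω) {γ : ℝ} (h0 : 0 < γ) (h2 : γ ≤ 2)
    (hκ : powerMoment P L R γ ≠ ∞) {μ : Measure ℝ} [IsProbabilityMeasure μ]
    (hsymm : μ.map (fun x => -x) = μ) (hμ : absMoment γ μ ≠ ∞) {t : ℝ} (ht : 0 ≤ t) :
    absMoment γ (wildSum P L R μ t) ≤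
      absMoment γ μ * ENNReal.ofReal (Real.exp (-(t * (1 - (powerMoment P L R γ).toReal)))) := by
  have hprob := fun n => isProbabilityMeasure_wild (P := P) hL hR μ n
  refine absMoment_wildSum_le hL hL0 hR0 hκ hμ (fun i j => ?_) ht
  refine absMoment_collide_le_of_symmetric hL hR hL0 hR0 h0 h2 _ _ ?_
  have h := map_wild (P := P) hL hR μ (-ContinuousLinearMap.id ℝ ℝ) j
  have e : ⇑(-ContinuousLinearMap.id ℝ ℝ) = fun x => -x := rfl
  rwa [e, hsymm] at h

/-- The `γ`-th absolute moment of a centered law, `1 ≤ γ ≤ 2`, decays exponentially along the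
evolution, up to a factor `2`. As in the inequality of von Bahr and Esseen, the law is compared to
its symmetrization; the two independent copies undergo the same collisions. -/
theorem absMoment_wildSum_le_of_centered (hL : Measurable L) (hR : Measurable R)
    (hL0 : ∀ᵐ ω ∂P, 0 ≤ L ω) (hR0 : ∀ᵐ ω ∂P, 0 ≤ R ω) (hLi : Integrable L P) (hRi : Integrable R P)
    {γ : ℝ} (h1 : 1 ≤ γ) (h2 : γ ≤ 2) (hκ : powerMoment P L R γ ≠ ∞) {μ : Measure ℝ}
    [IsProbabilityMeasure μ] (hint : Integrable (fun x => x) μ) (hmean : ∫ x, x ∂μ = 0)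
    (hμ : absMoment γ μ ≠ ∞) {t : ℝ} (ht : 0 ≤ t) :
    absMoment γ (wildSum P L R μ t) ≤ 2 * absMoment γ μ *
      ENNReal.ofReal (Real.exp (-(t * (1 - (powerMoment P L R γ).toReal)))) := by
  set ρ := μ.prod μ with hρ
  have hρprob := fun n => isProbabilityMeasure_wild (P := P) hL hR ρ n
  set T : ℝ × ℝ →L[ℝ] ℝ := ContinuousLinearMap.fst ℝ ℝ ℝ - ContinuousLinearMap.snd ℝ ℝ ℝ with hT
  have hTm : Measurable T := T.continuous.measurable
  have hfst : ρ.map (ContinuousLinearMap.fst ℝ ℝ ℝ) = μ := by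
    change ρ.map Prod.fst = μ
    simp [hρ]
  set σ := ρ.map T with hσ
  have hσprob : IsProbabilityMeasure σ := Measure.isProbabilityMeasure_map hTm.aemeasurable
  have hsymm : σ.map (fun x => -x) = σ := by
    rw [hσ, Measure.map_map (by fun_prop) hTm]
    conv_rhs => rw [hρ, ← Measure.prod_swap, Measure.map_map hTm measurable_swap]
    congr 1
    ext z
    simp [hT]
  have hσle : absMoment γ σ ≤ 2 * absMoment γ μ := by
    rw [absMoment, hσ, lintegral_map (measurable_ofReal_abs_rpow γ) hTm]
    exact lintegral_abs_sub_rpow_le (by linarith) h2 hint hmean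
  have hσtop : absMoment γ σ ≠ ∞ := ne_top_of_le_ne_top (ENNReal.mul_ne_top (by simp) hμ) hσle
  have hn : ∀ n, absMoment γ (wild P L R μ n) ≤ absMoment γ (wild P L R σ n) := by
    intro n
    rw [absMoment, absMoment, ← hfst, hσ, ← map_wild hL hR, ← map_wild hL hR,
      lintegral_map (measurable_ofReal_abs_rpow γ) (ContinuousLinearMap.continuous _).measurable,
      lintegral_map (measurable_ofReal_abs_rpow γ) hTm]
    exact ((condCentered_prod hint hmean).wild hL hR hLi hRi n).lintegral_abs_fst_rpow_le h1
  calc absMoment γ (wildSum P L R μ t) ≤ absMoment γ (wildSum P L R σ t) := by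
        rw [absMoment, absMoment, lintegral_wildSum, lintegral_wildSum]
        exact ENNReal.tsum_le_tsum fun n => mul_le_mul_right (hn n) _
    _ ≤ _ := absMoment_wildSum_le_of_symmetric hL hR hL0 hR0 (by linarith) h2 hκ hsymm hσtop ht
    _ ≤ _ := by gcongr

end CondCentered

/-! ### Growth of the mean -/

section Growth

/-- The factor by which the mean grows in the `n`-th Wild convolution, if `κ = E[L + R]`. -/
noncomputable def wildGrowth (κ : ℝ) : ℕ → ℝ
  | 0 => 1
  | n + 1 => (n + κ) / (n + 1) * wildGrowth κ n

@[simp]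
lemma wildGrowth_zero (κ : ℝ) : wildGrowth κ 0 = 1 := rfl

lemma succ_mul_wildGrowth_succ (κ : ℝ) (n : ℕ) :
    ((n : ℝ) + 1) * wildGrowth κ (n + 1) = (n + κ) * wildGrowth κ n := by
  have : (n : ℝ) + 1 ≠ 0 := by positivity
  rw [wildGrowth]
  field_simp

lemma succ_mul_wildGrowth_succ_eq_sum (κ : ℝ) (n : ℕ) :
    ((n : ℝ) + 1) * wildGrowth κ (n + 1) = κ * ∑ j ∈ Finset.range (n + 1), wildGrowth κ j := by
  induction n with
  | zero => simp [wildGrowth]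
  | succ n ih =>
    rw [succ_mul_wildGrowth_succ, Finset.sum_range_succ, mul_add, ← ih]
    push_cast
    ring

variable {κ : ℝ}

lemma one_le_wildGrowth (hκ : 1 ≤ κ) (n : ℕ) : 1 ≤ wildGrowth κ n := by
  induction n with
  | zero => simp
  | succ n ih =>
    rw [wildGrowth]
    refine one_le_mul_of_one_le_of_one_le ?_ ih
    rw [one_le_div (by positivity)]
    linarith

lemma wildGrowth_succ_sub (κ : ℝ) (n : ℕ) :
    wildGrowth κ (n + 1) - wildGrowth κ n = (κ - 1) * (1 / ((n : ℝ) + 1)) * wildGrowth κ n := by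
  have h : (n : ℝ) + 1 ≠ 0 := by positivity
  rw [wildGrowth]
  field_simp
  ring

lemma wildGrowth_succ_sub_nonneg (hκ : 1 ≤ κ) (n : ℕ) :
    0 ≤ wildGrowth κ (n + 1) - wildGrowth κ n := by
  rw [wildGrowth_succ_sub]
  have := one_le_wildGrowth hκ n
  have : 0 ≤ κ - 1 := by linarith
  positivity

lemma monotone_wildGrowth (hκ : 1 ≤ κ) : Monotone (wildGrowth κ) :=
  monotone_nat_of_le_succ fun n => sub_nonneg.1 (wildGrowth_succ_sub_nonneg hκ n)

/-- The growth is at least that of the harmonic series. -/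
lemma tendsto_wildGrowth (hκ : 1 < κ) : Tendsto (wildGrowth κ) atTop atTop := by
  have hle : ∀ n, (κ - 1) * ∑ i ∈ Finset.range n, 1 / ((i : ℝ) + 1) ≤ wildGrowth κ n := by
    intro n
    induction n with
    | zero => simp
    | succ n ih =>
      rw [Finset.sum_range_succ, mul_add]
      have h1 := wildGrowth_succ_sub κ n
      have h2 := one_le_wildGrowth hκ.le n
      have h3 : 0 ≤ (κ - 1) * (1 / ((n : ℝ) + 1)) := by
        have : 0 ≤ κ - 1 := by linarith
        positivity
      have h4 := mul_le_mul_of_nonneg_left h2 h3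
      linarith
  exact tendsto_atTop_mono hle
    (Real.tendsto_sum_range_one_div_nat_succ_atTop.const_mul_atTop (by linarith))

lemma summable_wildGrowth_mul_pow (hκ : 1 ≤ κ) {x : ℝ} (hx : x ∈ Ico (0 : ℝ) 1) :
    Summable fun n => wildGrowth κ n * x ^ n := by
  have hnn : ∀ n, 0 ≤ wildGrowth κ n := fun n => zero_le_one.trans (one_le_wildGrowth hκ n)
  have hx1 : 0 < 1 - x := by linarith [hx.2]
  have key := one_sub_mul_sum_le_of_recursion (y := wildGrowth κ) (h := 0) (H := 0) (K := 0)
    hnn (by linarith : 0 ≤ κ) le_rfl (by simp)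
    (fun n => by simpa using (succ_mul_wildGrowth_succ_eq_sum κ n).le) hx (by simp)
  refine summable_of_sum_range_le (c := (1 - x) ^ (1 - κ) / (1 - x))
    (fun n => mul_nonneg (hnn n) (pow_nonneg hx.1 n)) fun N => ?_
  rw [le_div_iff₀ hx1, mul_comm]
  refine le_trans ?_ ((key N).trans_eq (by simp))
  refine mul_le_mul_of_nonneg_left ?_ hx1.le
  exact Finset.sum_le_sum_of_subset_of_nonneg (Finset.range_mono (Nat.le_succ N))
    fun i _ _ => mul_nonneg (hnn i) (pow_nonneg hx.1 i)

/-- The geometric average of `wildGrowth`, that is, the growth factor of the mean along the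
evolution if `1 - x = e⁻ᵗ`. -/
noncomputable def meanGrowth (κ x : ℝ) : ℝ := (1 - x) * ∑' n : ℕ, wildGrowth κ n * x ^ n

lemma meanGrowth_eq (hκ : 1 ≤ κ) {x : ℝ} (hx : x ∈ Ico (0 : ℝ) 1) :
    Summable (fun n : ℕ => (wildGrowth κ (n + 1) - wildGrowth κ n) * x ^ (n + 1)) ∧
    meanGrowth κ x = 1 + ∑' n : ℕ, (wildGrowth κ (n + 1) - wildGrowth κ n) * x ^ (n + 1) := by
  have hs := summable_wildGrowth_mul_pow hκ hx
  have hs1 := (summable_nat_add_iff 1).2 hs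
  have hsx := hs.mul_left x
  have e : ∀ n : ℕ, (wildGrowth κ (n + 1) - wildGrowth κ n) * x ^ (n + 1) =
      wildGrowth κ (n + 1) * x ^ (n + 1) - x * (wildGrowth κ n * x ^ n) := by
    intro n
    ring
  simp_rw [e]
  refine ⟨hs1.sub hsx, ?_⟩
  rw [hs1.tsum_sub hsx, tsum_mul_left, meanGrowth, sub_mul, one_mul]
  conv_lhs => rw [hs.tsum_eq_zero_add]
  rw [wildGrowth_zero, pow_zero, hs.tsum_eq_zero_add]
  simp
  ring

lemma one_le_meanGrowth (hκ : 1 ≤ κ) {x : ℝ} (hx : x ∈ Ico (0 : ℝ) 1) : 1 ≤ meanGrowth κ x := by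
  rw [(meanGrowth_eq hκ hx).2]
  have : 0 ≤ ∑' n : ℕ, (wildGrowth κ (n + 1) - wildGrowth κ n) * x ^ (n + 1) :=
    tsum_nonneg fun n => mul_nonneg (wildGrowth_succ_sub_nonneg hκ n) (pow_nonneg hx.1 _)
  linarith

lemma meanGrowth_mono (hκ : 1 ≤ κ) {x y : ℝ} (hx : x ∈ Ico (0 : ℝ) 1) (hy : y ∈ Ico (0 : ℝ) 1)
    (hxy : x ≤ y) : meanGrowth κ x ≤ meanGrowth κ y := by
  rw [(meanGrowth_eq hκ hx).2, (meanGrowth_eq hκ hy).2]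
  gcongr 1 + ?_
  refine (meanGrowth_eq hκ hx).1.tsum_le_tsum (fun n => ?_) (meanGrowth_eq hκ hy).1
  exact mul_le_mul_of_nonneg_left (pow_le_pow_left₀ hx.1 hxy _) (wildGrowth_succ_sub_nonneg hκ n)

lemma meanGrowth_one {x : ℝ} (hx : x ∈ Ico (0 : ℝ) 1) : meanGrowth 1 x = 1 := by
  rw [(meanGrowth_eq le_rfl hx).2]
  simp [wildGrowth_succ_sub]

lemma wildGrowth_mul_pow_le_meanGrowth (hκ : 1 ≤ κ) {x : ℝ} (hx : x ∈ Ico (0 : ℝ) 1) (N : ℕ) :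
    wildGrowth κ N * x ^ N ≤ meanGrowth κ x := by
  have hs := summable_wildGrowth_mul_pow hκ hx
  have hx1 : 0 < 1 - x := by linarith [hx.2]
  have hnn : ∀ n, 0 ≤ wildGrowth κ n := fun n => zero_le_one.trans (one_le_wildGrowth hκ n)
  have hg := (summable_geometric_of_lt_one hx.1 hx.2).mul_left (wildGrowth κ N * x ^ N)
  have h1 : ∑' n : ℕ, wildGrowth κ N * x ^ N * x ^ n ≤ ∑' n : ℕ, wildGrowth κ n * x ^ n := by
    calc _ ≤ ∑' n : ℕ, wildGrowth κ (n + N) * x ^ (n + N) := by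
          refine hg.tsum_le_tsum (fun n => ?_) ((summable_nat_add_iff N).2 hs)
          rw [pow_add, mul_assoc, mul_comm (x ^ N)]
          refine mul_le_mul_of_nonneg_right (monotone_wildGrowth hκ (by omega)) ?_
          exact mul_nonneg (pow_nonneg hx.1 _) (pow_nonneg hx.1 _)
      _ ≤ _ := by
          rw [← hs.sum_add_tsum_nat_add N]
          have : 0 ≤ ∑ i ∈ Finset.range N, wildGrowth κ i * x ^ i :=
            Finset.sum_nonneg fun i _ => mul_nonneg (hnn i) (pow_nonneg hx.1 _)
          linarith
  rw [tsum_mul_left, tsum_geometric_of_lt_one hx.1 hx.2] at h1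
  calc wildGrowth κ N * x ^ N = (1 - x) * (wildGrowth κ N * x ^ N * (1 - x)⁻¹) := by
        field_simp
    _ ≤ meanGrowth κ x := by
        rw [meanGrowth]
        gcongr

lemma tendsto_meanGrowth (hκ : 1 < κ) :
    Tendsto (fun t : ℝ => meanGrowth κ (1 - Real.exp (-t))) atTop atTop := by
  rw [tendsto_atTop]
  intro M
  obtain ⟨N, hN⟩ := ((tendsto_wildGrowth hκ).eventually_gt_atTop M).exists
  have hlim : Tendsto (fun t : ℝ => wildGrowth κ N * (1 - Real.exp (-t)) ^ N) atTop
      (𝓝 (wildGrowth κ N * (1 - 0) ^ N)) :=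
    ((Real.tendsto_exp_neg_atTop_nhds_zero.const_sub 1).pow N).const_mul _
  rw [sub_zero, one_pow, mul_one] at hlim
  filter_upwards [hlim.eventually_const_lt hN, eventually_ge_atTop 0] with t h1 h2
  exact h1.le.trans (wildGrowth_mul_pow_le_meanGrowth hκ.le (one_sub_exp_neg_mem h2) N)

end Growth

section FirstMoment

variable {Ω : Type*} [MeasurableSpace Ω] {P : Measure Ω} [IsProbabilityMeasure P] {L R : Ω → ℝ}

lemma integrable_id_iff_absMoment {μ : Measure ℝ} :
    Integrable (fun x => x) μ ↔ absMoment 1 μ ≠ ∞ := by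
  rw [← lt_top_iff_ne_top, absMoment]
  simp only [Real.rpow_one]
  constructor
  · intro h
    have := h.2
    rw [hasFiniteIntegral_iff_norm] at this
    exact this
  · intro h
    refine ⟨by fun_prop, ?_⟩
    rw [hasFiniteIntegral_iff_norm]
    exact h

lemma absMoment_wild_le (hL : Measurable L) (hR : Measurable R) (hL0 : ∀ᵐ ω ∂P, 0 ≤ L ω)
    (hR0 : ∀ᵐ ω ∂P, 0 ≤ R ω) (hκ : powerMoment P L R 1 ≠ ∞) {μ : Measure ℝ}
    [IsProbabilityMeasure μ] (hμ : absMoment 1 μ ≠ ∞) (n : ℕ) :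
    absMoment 1 (wild P L R μ n) ≤
      ENNReal.ofReal ((absMoment 1 μ).toReal * wildGrowth (powerMoment P L R 1).toReal n) := by
  have hprob := fun n => isProbabilityMeasure_wild (P := P) hL hR μ n
  have hu : ∀ n, 0 ≤ wildGrowth (powerMoment P L R 1).toReal n := by
    intro n
    induction n with
    | zero => simp
    | succ n ih =>
      rw [wildGrowth]
      have : 0 ≤ (powerMoment P L R 1).toReal := ENNReal.toReal_nonneg
      positivity
  induction n using Nat.strong_induction_on with
  | _ n ih =>
    cases n with
    | zero => simp [ENNReal.ofReal_toReal hμ]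
    | succ n =>
      have h0 : (n : ℝ≥0∞) + 1 ≠ 0 := by simp
      rw [← ENNReal.mul_le_mul_iff_right h0 (natCast_add_one_ne_top n)]
      have e : (n : ℝ≥0∞) + 1 = ENNReal.ofReal ((n : ℝ) + 1) := by
        rw [ENNReal.ofReal_add (by positivity) zero_le_one, ENNReal.ofReal_natCast,
          ENNReal.ofReal_one]
      calc ((n : ℝ≥0∞) + 1) * absMoment 1 (wild P L R μ (n + 1))
          ≤ ∑ i ∈ Finset.range (n + 1),
            ((∫⁻ ω, ENNReal.ofReal (L ω ^ (1 : ℝ)) ∂P) * absMoment 1 (wild P L R μ i)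
            + (∫⁻ ω, ENNReal.ofReal (R ω ^ (1 : ℝ)) ∂P) * absMoment 1 (wild P L R μ (n - i))) := by
            rw [absMoment, lintegral_wild_succ]
            exact Finset.sum_le_sum fun i _ =>
              absMoment_collide_le_of_le_one hL hR hL0 hR0 one_pos le_rfl _ _
        _ = powerMoment P L R 1 * ∑ i ∈ Finset.range (n + 1), absMoment 1 (wild P L R μ i) := by
            rw [powerMoment_eq_add hL hL0 hR0]
            exact sum_range_recursion _ _ (fun i => absMoment 1 (wild P L R μ i)) n
        _ ≤ powerMoment P L R 1 * ∑ i ∈ Finset.range (n + 1), ENNReal.ofReal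
            ((absMoment 1 μ).toReal * wildGrowth (powerMoment P L R 1).toReal i) := by
            gcongr with i hi
            exact ih i (Finset.mem_range.1 hi)
        _ = _ := by
            rw [e, ← ENNReal.ofReal_mul (by positivity), ← ENNReal.ofReal_sum_of_nonneg
              fun i _ => mul_nonneg ENNReal.toReal_nonneg (hu i), ← Finset.mul_sum,
              ← mul_left_comm, succ_mul_wildGrowth_succ_eq_sum]
            conv_lhs =>
              lhs
              rw [← ENNReal.ofReal_toReal hκ]
            rw [← ENNReal.ofReal_mul ENNReal.toReal_nonneg]
            congr 1
            ring

lemma integral_id_collide (hL : Measurable L) (hR : Measurable R) (hLi : Integrable L P)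
    (hRi : Integrable R P) {μ ν : Measure ℝ} [IsProbabilityMeasure μ] [IsProbabilityMeasure ν]
    (hμ : Integrable (fun x => x) μ) (hν : Integrable (fun x => x) ν) :
    Integrable (fun x => x) (collide P L R μ ν) ∧ ∫ x, x ∂(collide P L R μ ν) =
      (∫ ω, L ω ∂P) * ∫ x, x ∂μ + (∫ ω, R ω ∂P) * ∫ x, x ∂ν := by
  have hm := measurable_collision (E := ℝ) hL hR
  have i1 : Integrable (fun p : Ω × ℝ × ℝ => L p.1 * p.2.1) (P.prod (μ.prod ν)) :=
    hLi.mul_prod (hμ.comp_fst ν)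
  have i2 : Integrable (fun p : Ω × ℝ × ℝ => R p.1 * p.2.2) (P.prod (μ.prod ν)) :=
    hRi.mul_prod (hν.comp_snd μ)
  constructor
  · rw [collide, integrable_map_measure (by fun_prop) hm.aemeasurable]
    exact i1.add i2
  · rw [collide, integral_map hm.aemeasurable (by fun_prop)]
    simp only [smul_eq_mul]
    rw [integral_add i1 i2, integral_prod_mul L (fun q : ℝ × ℝ => q.1),
      integral_prod_mul R (fun q : ℝ × ℝ => q.2)]
    congr 2
    · rw [integral_prod _ (hμ.comp_fst ν)]
      simp
    · rw [integral_prod _ (hν.comp_snd μ)]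
      simp

lemma toReal_powerMoment_one (hL0 : ∀ᵐ ω ∂P, 0 ≤ L ω) (hR0 : ∀ᵐ ω ∂P, 0 ≤ R ω)
    (hLi : Integrable L P) (hRi : Integrable R P) :
    powerMoment P L R 1 ≠ ∞ ∧ (powerMoment P L R 1).toReal = ∫ ω, L ω ∂P + ∫ ω, R ω ∂P := by
  have h : powerMoment P L R 1 = ENNReal.ofReal (∫ ω, L ω ∂P + ∫ ω, R ω ∂P) := by
    have hadd : Integrable (fun ω => L ω + R ω) P := hLi.add hRi
    rw [← integral_add hLi hRi, ofReal_integral_eq_lintegral_ofReal hadd, powerMoment]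
    · simp only [Real.rpow_one]
    · filter_upwards [hL0, hR0] with ω h1 h2 using add_nonneg h1 h2
  rw [h]
  exact ⟨ENNReal.ofReal_ne_top, ENNReal.toReal_ofReal
    (add_nonneg (integral_nonneg_of_ae hL0) (integral_nonneg_of_ae hR0))⟩

lemma integral_id_wild (hL : Measurable L) (hR : Measurable R) (hL0 : ∀ᵐ ω ∂P, 0 ≤ L ω)
    (hR0 : ∀ᵐ ω ∂P, 0 ≤ R ω) (hLi : Integrable L P) (hRi : Integrable R P) {μ : Measure ℝ}
    [IsProbabilityMeasure μ] (hμ : Integrable (fun x => x) μ) (n : ℕ) :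
    Integrable (fun x => x) (wild P L R μ n) ∧ ∫ x, x ∂(wild P L R μ n) =
      (∫ x, x ∂μ) * wildGrowth (powerMoment P L R 1).toReal n := by
  have hprob := fun n => isProbabilityMeasure_wild (P := P) hL hR μ n
  have hκ := toReal_powerMoment_one hL0 hR0 hLi hRi
  have hint : ∀ n, Integrable (fun x => x) (wild P L R μ n) := fun n =>
    integrable_id_iff_absMoment.2 (ne_top_of_le_ne_top ENNReal.ofReal_ne_top
      (absMoment_wild_le hL hR hL0 hR0 hκ.1 (integrable_id_iff_absMoment.1 hμ) n))
  refine ⟨hint n, ?_⟩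
  induction n using Nat.strong_induction_on with
  | _ n ih =>
    cases n with
    | zero => simp
    | succ n =>
      have h := integral_wild_succ (P := P) (L := L) (R := R) μ n (fun x => x)
        fun i _ => (integral_id_collide hL hR hLi hRi (hint i) (hint (n - i))).1
      have e : ∀ i ∈ Finset.range (n + 1),
          ∫ x, x ∂(collide P L R (wild P L R μ i) (wild P L R μ (n - i))) =
          (∫ x, x ∂μ) * ((∫ ω, L ω ∂P) * wildGrowth (powerMoment P L R 1).toReal i +
            (∫ ω, R ω ∂P) * wildGrowth (powerMoment P L R 1).toReal (n - i)) := by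
        intro i hi
        rw [Finset.mem_range] at hi
        rw [(integral_id_collide hL hR hLi hRi (hint i) (hint (n - i))).2, ih i hi,
          ih (n - i) (by omega)]
        ring
      have hrefl : ∑ i ∈ Finset.range (n + 1), wildGrowth (powerMoment P L R 1).toReal (n - i) =
          ∑ i ∈ Finset.range (n + 1), wildGrowth (powerMoment P L R 1).toReal i := by
        simpa using Finset.sum_range_reflect (wildGrowth (powerMoment P L R 1).toReal) (n + 1)
      rw [Finset.sum_congr rfl e, ← Finset.mul_sum, Finset.sum_add_distrib, ← Finset.mul_sum,
        ← Finset.mul_sum, hrefl, ← add_mul, ← hκ.2, ← succ_mul_wildGrowth_succ_eq_sum,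
        smul_eq_mul] at h
      have hn : (n : ℝ) + 1 ≠ 0 := by positivity
      refine mul_left_cancel₀ hn (h.trans ?_)
      ring

end FirstMoment

/-! ### Growth of moments of order between one and two -/

section MomentGrowth

variable {Ω : Type*} [MeasurableSpace Ω] {P : Measure Ω} [IsProbabilityMeasure P] {L R : Ω → ℝ}

lemma hasSum_meanGrowth {κ : ℝ} (hκ : 1 ≤ κ) {t : ℝ} (ht : 0 ≤ t) :
    HasSum (fun n : ℕ => Real.exp (-t) * (1 - Real.exp (-t)) ^ n * wildGrowth κ n)
      (meanGrowth κ (1 - Real.exp (-t))) := by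
  have h := ((summable_wildGrowth_mul_pow hκ (one_sub_exp_neg_mem ht)).hasSum).mul_left
    (Real.exp (-t))
  rw [meanGrowth, sub_sub_cancel]
  refine h.congr_fun fun n => ?_
  ring

lemma absMoment_one_wildSum_le (hL : Measurable L) (hR : Measurable R) (hL0 : ∀ᵐ ω ∂P, 0 ≤ L ω)
    (hR0 : ∀ᵐ ω ∂P, 0 ≤ R ω) (hκ : powerMoment P L R 1 ≠ ∞)
    (hκ1 : 1 ≤ (powerMoment P L R 1).toReal) {μ : Measure ℝ} [IsProbabilityMeasure μ]
    (hμ : absMoment 1 μ ≠ ∞) {t : ℝ} (ht : 0 ≤ t) :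
    absMoment 1 (wildSum P L R μ t) ≤ ENNReal.ofReal ((absMoment 1 μ).toReal *
      meanGrowth (powerMoment P L R 1).toReal (1 - Real.exp (-t))) := by
  have hs := (hasSum_meanGrowth hκ1 ht).mul_left (absMoment 1 μ).toReal
  have hu : ∀ n, 0 ≤ (absMoment 1 μ).toReal * wildGrowth (powerMoment P L R 1).toReal n :=
    fun n => mul_nonneg ENNReal.toReal_nonneg (zero_le_one.trans (one_le_wildGrowth hκ1 n))
  rw [absMoment, lintegral_wildSum, ← hs.tsum_eq, ENNReal.ofReal_tsum_of_nonneg _ hs.summable]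
  · refine ENNReal.tsum_le_tsum fun n => ?_
    calc _ ≤ ENNReal.ofReal (Real.exp (-t) * (1 - Real.exp (-t)) ^ n) * ENNReal.ofReal
          ((absMoment 1 μ).toReal * wildGrowth (powerMoment P L R 1).toReal n) := by
          gcongr
          exact absMoment_wild_le hL hR hL0 hR0 hκ hμ n
      _ = _ := by
          rw [← ENNReal.ofReal_mul (wild_weight_nonneg ht n)]
          congr 1
          ring
  · intro n
    have := mul_nonneg (wild_weight_nonneg ht n) (hu n)
    linarith

lemma integral_id_wildSum (hL : Measurable L) (hR : Measurable R) (hL0 : ∀ᵐ ω ∂P, 0 ≤ L ω)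
    (hR0 : ∀ᵐ ω ∂P, 0 ≤ R ω) (hLi : Integrable L P) (hRi : Integrable R P)
    (hκ1 : 1 ≤ (powerMoment P L R 1).toReal) {μ : Measure ℝ}
    [IsProbabilityMeasure μ] (hμ : Integrable (fun x => x) μ) {t : ℝ} (ht : 0 ≤ t) :
    Integrable (fun x => x) (wildSum P L R μ t) ∧ ∫ x, x ∂(wildSum P L R μ t) =
      (∫ x, x ∂μ) * meanGrowth (powerMoment P L R 1).toReal (1 - Real.exp (-t)) := by
  have hκ := (toReal_powerMoment_one hL0 hR0 hLi hRi).1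
  have hint : Integrable (fun x => x) (wildSum P L R μ t) :=
    integrable_id_iff_absMoment.2 (ne_top_of_le_ne_top ENNReal.ofReal_ne_top
      (absMoment_one_wildSum_le hL hR hL0 hR0 hκ hκ1 (integrable_id_iff_absMoment.1 hμ) ht))
  refine ⟨hint, (integral_wildSum μ ht hint).unique ?_⟩
  refine ((hasSum_meanGrowth hκ1 ht).mul_left (∫ x, x ∂μ)).congr_fun fun n => ?_
  rw [(integral_id_wild hL hR hL0 hR0 hLi hRi hμ n).2, smul_eq_mul]
  ring

lemma absMoment_collide_le_add_cross (hL : Measurable L) (hR : Measurable R)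
    (hL0 : ∀ᵐ ω ∂P, 0 ≤ L ω) (hR0 : ∀ᵐ ω ∂P, 0 ≤ R ω) {γ G : ℝ} (h1 : 1 ≤ γ) (h2 : γ ≤ 2)
    (hG : 0 < G) (μ ν : Measure ℝ) [IsProbabilityMeasure μ] [IsProbabilityMeasure ν] :
    absMoment γ (collide P L R μ ν) ≤ (∫⁻ ω, ENNReal.ofReal (L ω ^ γ) ∂P) * absMoment γ μ
      + (∫⁻ ω, ENNReal.ofReal (R ω ^ γ) ∂P) * absMoment γ ν
      + powerMoment P L R γ * ENNReal.ofReal (2 * G ^ (γ - 2)) *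
        ((ENNReal.ofReal G + absMoment 1 μ) * (ENNReal.ofReal G + absMoment 1 ν)) := by
  have hmL : Measurable fun ω => ENNReal.ofReal (L ω ^ γ) := by fun_prop
  have hmR : Measurable fun ω => ENNReal.ofReal (R ω ^ γ) := by fun_prop
  have hmC : Measurable fun ω =>
      ENNReal.ofReal (L ω ^ γ + R ω ^ γ) * ENNReal.ofReal (2 * G ^ (γ - 2)) := by fun_prop
  have hg : ∀ ρ : Measure ℝ, [IsProbabilityMeasure ρ] →
      ∫⁻ x, ENNReal.ofReal (G + |x|) ∂ρ = ENNReal.ofReal G + absMoment 1 ρ := by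
    intro ρ _
    simp_rw [fun x : ℝ => ENNReal.ofReal_add hG.le (abs_nonneg x)]
    rw [lintegral_add_left (by fun_prop), absMoment]
    simp
  rw [absMoment, lintegral_collide hL hR μ ν (measurable_ofReal_abs_rpow γ)]
  refine (lintegral_collision_le hmL hmR hmC (measurable_ofReal_abs_rpow γ)
    (g := fun x => ENNReal.ofReal (G + |x|)) (by fun_prop) ?_).trans_eq ?_
  · filter_upwards [ae_nonneg_fst hL0, ae_nonneg_fst hR0] with p hp1 hp2
    have hGγ : 0 ≤ 2 * G ^ (γ - 2) := by positivity
    rw [← ENNReal.ofReal_mul (by positivity), ← ENNReal.ofReal_mul (by positivity),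
      ← ENNReal.ofReal_mul (by positivity), ← ENNReal.ofReal_mul (by positivity),
      ← ENNReal.ofReal_mul (by positivity), ← ENNReal.ofReal_add (by positivity) (by positivity),
      ← ENNReal.ofReal_add (by positivity) (by positivity)]
    exact ENNReal.ofReal_le_ofReal (abs_add_rpow_le_add_cross h1 h2 hG hp1 hp2 _ _)
  · rw [hg μ, hg ν, lintegral_mul_const _ (by fun_prop)]
    rfl

lemma sum_convolution_le {a : ℕ → ℝ} {x S : ℝ} (ha : ∀ n, 0 ≤ a n) (hx : 0 ≤ x)
    (hs : HasSum (fun n => a n * x ^ n) S) (N : ℕ) :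
    ∑ n ∈ Finset.range N, (∑ i ∈ Finset.range (n + 1), a i * a (n - i)) * x ^ n ≤ S ^ 2 := by
  have hnn : ∀ n, 0 ≤ a n * x ^ n := fun n => mul_nonneg (ha n) (pow_nonneg hx n)
  have hnorm : Summable fun n => ‖a n * x ^ n‖ := hs.summable.norm
  have hprod := tsum_mul_tsum_eq_tsum_sum_range_of_summable_norm hnorm hnorm
  have hsum := (summable_norm_sum_mul_range_of_summable_norm hnorm hnorm).of_norm
  rw [hs.tsum_eq, ← sq] at hprod
  rw [hprod]
  refine le_trans (le_of_eq ?_) (hsum.sum_le_tsum (Finset.range N) fun n _ =>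
    Finset.sum_nonneg fun i _ => mul_nonneg (hnn _) (hnn _))
  refine Finset.sum_congr rfl fun n _ => ?_
  rw [Finset.sum_mul]
  refine Finset.sum_congr rfl fun i hi => ?_
  have : x ^ n = x ^ i * x ^ (n - i) := by
    rw [Finset.mem_range] at hi
    rw [← pow_add]
    congr 1
    omega
  rw [this]
  ring

/-- The `γ`-th absolute moment, `1 ≤ γ ≤ 2`, grows at most like the `γ`-th power of the mean. The
cross term in a collision is estimated with the value of the mean at the final time as reference
scale, and is summed up by means of `E[L ^ γ + R ^ γ] < 1`. -/
theorem absMoment_wildSum_le_meanGrowth (hL : Measurable L) (hR : Measurable R)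
    (hL0 : ∀ᵐ ω ∂P, 0 ≤ L ω) (hR0 : ∀ᵐ ω ∂P, 0 ≤ R ω) {γ : ℝ} (h1 : 1 ≤ γ) (h2 : γ ≤ 2)
    (hκ : powerMoment P L R 1 ≠ ∞) (hκ1 : 1 ≤ (powerMoment P L R 1).toReal)
    (hγ : powerMoment P L R γ < 1) {μ : Measure ℝ} [IsProbabilityMeasure μ]
    (hμ1 : absMoment 1 μ ≠ ∞) (hμγ : absMoment γ μ ≠ ∞) :
    ∃ C : ℝ, 0 ≤ C ∧ ∀ t : ℝ, 0 ≤ t → absMoment γ (wildSum P L R μ t) ≤ ENNReal.ofReal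
      (C * meanGrowth (powerMoment P L R 1).toReal (1 - Real.exp (-t)) ^ γ) := by
  have hprob := fun n => isProbabilityMeasure_wild (P := P) hL hR μ n
  set κ := (powerMoment P L R 1).toReal with hκdef
  set k := (powerMoment P L R γ).toReal with hkdef
  have hktop : powerMoment P L R γ ≠ ∞ := (hγ.trans ENNReal.one_lt_top).ne
  have hk0 : 0 ≤ k := ENNReal.toReal_nonneg
  have hk1 : 0 < 1 - k := by
    have := (ENNReal.toReal_lt_toReal hktop ENNReal.one_ne_top).2 hγ
    rw [ENNReal.toReal_one] at this
    linarith
  set z := (absMoment 1 μ).toReal with hzdef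
  have hz : 0 ≤ z := ENNReal.toReal_nonneg
  refine ⟨(absMoment γ μ).toReal + 2 * k * (1 + z) ^ 2 / (1 - k), by positivity, fun t ht => ?_⟩
  set G := meanGrowth κ (1 - Real.exp (-t)) with hGdef
  have hx₀ := one_sub_exp_neg_mem ht
  have hG1 : 1 ≤ G := one_le_meanGrowth hκ1 hx₀
  have hG : 0 < G := by linarith
  set a : ℕ → ℝ := fun i => G + z * wildGrowth κ i with ha
  have hu : ∀ i, 0 ≤ wildGrowth κ i := fun i => zero_le_one.trans (one_le_wildGrowth hκ1 i)
  have ha0 : ∀ i, 0 ≤ a i := fun i => add_nonneg hG.le (mul_nonneg hz (hu i))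
  set h : ℕ → ℝ := fun n =>
    k * (2 * G ^ (γ - 2)) * ∑ i ∈ Finset.range (n + 1), a i * a (n - i) with hh
  have hGγ : 0 ≤ 2 * G ^ (γ - 2) := by positivity
  have hh0 : ∀ n, 0 ≤ h n := fun n => mul_nonneg (mul_nonneg hk0 hGγ)
    (Finset.sum_nonneg fun i _ => mul_nonneg (ha0 _) (ha0 _))
  have hfirst : ∀ i, ENNReal.ofReal G + absMoment 1 (wild P L R μ i) ≤ ENNReal.ofReal (a i) := by
    intro i
    rw [ENNReal.ofReal_add hG.le (mul_nonneg hz (hu i))]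
    gcongr
    exact absMoment_wild_le hL hR hL0 hR0 hκ hμ1 i
  have hpow : G ^ (γ - 2) * G ^ 2 = G ^ γ := by
    rw [← Real.rpow_natCast, ← Real.rpow_add hG]
    congr 1
    push_cast
    ring
  set K := 2 * k * (1 + z) ^ 2 / (1 - k) * G ^ γ with hK
  have hK0 : 0 ≤ K := by positivity
  have key := tsum_wild_weight_mul_le (y := fun n => absMoment γ (wild P L R μ n)) (h := h)
    (H := K * (1 - k)) (K := K) (κ := powerMoment P L R γ) (t := t) hktop (by simpa) hh0 hK0
    le_rfl ?_ ht ?_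
  · rw [wild_zero] at key
    rw [absMoment, lintegral_wildSum]
    refine key.trans ?_
    have e1 : ENNReal.ofReal (Real.exp (-(t * (1 - k)))) ≤ 1 := by
      rw [ENNReal.ofReal_le_one, Real.exp_le_one_iff]
      have := mul_nonneg ht hk1.le
      linarith
    have e2 : (absMoment γ μ).toReal ≤ (absMoment γ μ).toReal * G ^ γ :=
      le_mul_of_one_le_right ENNReal.toReal_nonneg (Real.one_le_rpow hG1 (by linarith))
    calc _ ≤ absMoment γ μ * 1 + ENNReal.ofReal K := by gcongr
      _ = ENNReal.ofReal ((absMoment γ μ).toReal + K) := by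
          rw [ENNReal.ofReal_add ENNReal.toReal_nonneg hK0, ENNReal.ofReal_toReal hμγ, mul_one]
      _ ≤ _ := ENNReal.ofReal_le_ofReal (by rw [add_mul]; linarith)
  · intro n
    have hhn : ENNReal.ofReal (h n) = ∑ i ∈ Finset.range (n + 1),
        ENNReal.ofReal (k * (2 * G ^ (γ - 2)) * (a i * a (n - i))) := by
      simp only [hh]
      rw [Finset.mul_sum, ENNReal.ofReal_sum_of_nonneg fun i _ => mul_nonneg (mul_nonneg hk0 hGγ)
        (mul_nonneg (ha0 _) (ha0 _))]
    rw [absMoment, lintegral_wild_succ, powerMoment_eq_add hL hL0 hR0, ← sum_range_recursion, hhn,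
      ← Finset.sum_add_distrib]
    refine Finset.sum_le_sum fun i _ => ?_
    refine (absMoment_collide_le_add_cross hL hR hL0 hR0 h1 h2 hG _ _).trans ?_
    rw [ENNReal.ofReal_mul (mul_nonneg hk0 hGγ), ENNReal.ofReal_mul hk0,
      ENNReal.ofReal_mul (ha0 _), hkdef, ENNReal.ofReal_toReal hktop]
    gcongr
    · exact hfirst i
    · exact hfirst (n - i)
  · intro x hx N
    have hx1 : x ∈ Ico (0 : ℝ) 1 := ⟨hx.1, hx.2.trans_lt hx₀.2⟩
    have hpos : 0 < 1 - x := by linarith [hx1.2]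
    have hsum : HasSum (fun n => a n * x ^ n) ((G + z * meanGrowth κ x) / (1 - x)) := by
      have s1 := (hasSum_geometric_of_lt_one hx1.1 hx1.2).mul_left G
      have s2 := ((summable_wildGrowth_mul_pow hκ1 hx1).hasSum).mul_left z
      have e : (G + z * meanGrowth κ x) / (1 - x) =
          G * (1 - x)⁻¹ + z * ∑' n : ℕ, wildGrowth κ n * x ^ n := by
        rw [meanGrowth]
        field_simp
      rw [e]
      refine (s1.add s2).congr_fun fun n => ?_
      simp only [ha]
      ring
    have hmono := meanGrowth_mono hκ1 hx1 hx₀ hx.2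
    have hgx := one_le_meanGrowth hκ1 hx1
    calc ∑ n ∈ Finset.range N, h n * x ^ n = k * (2 * G ^ (γ - 2)) * ∑ n ∈ Finset.range N,
          (∑ i ∈ Finset.range (n + 1), a i * a (n - i)) * x ^ n := by
          rw [Finset.mul_sum]
          exact Finset.sum_congr rfl fun n _ => by simp only [hh]; ring
      _ ≤ k * (2 * G ^ (γ - 2)) * ((G + z * meanGrowth κ x) / (1 - x)) ^ 2 := by
          gcongr
          exact sum_convolution_le ha0 hx1.1 hsum N
      _ ≤ k * (2 * G ^ (γ - 2)) * ((G + z * G) / (1 - x)) ^ 2 := by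
          gcongr
      _ = 2 * k * (1 + z) ^ 2 * (G ^ (γ - 2) * G ^ 2) / (1 - x) ^ 2 := by
          rw [div_pow]
          ring
      _ = K * (1 - k) / (1 - x) ^ 2 := by
          rw [hpow, hK]
          field_simp

end MomentGrowth

/-! ### Weak limits -/

section WeakLimit

lemma integrable_abs_rpow_of_absMoment_le {s c : ℝ} (hc : 0 ≤ c) {μ : Measure ℝ}
    (h : absMoment s μ ≤ ENNReal.ofReal c) :
    Integrable (fun x => |x| ^ s) μ ∧ ∫ x, |x| ^ s ∂μ ≤ c := by
  have hint : Integrable (fun x => |x| ^ s) μ := by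
    refine ⟨Measurable.aestronglyMeasurable (by fun_prop), ?_⟩
    rw [hasFiniteIntegral_iff_ofReal (ae_of_all _ fun z => by positivity)]
    exact h.trans_lt ENNReal.ofReal_lt_top
  refine ⟨hint, ?_⟩
  rw [absMoment, ← ofReal_integral_eq_lintegral_ofReal hint
    (ae_of_all _ fun z => by positivity)] at h
  exact (ENNReal.ofReal_le_ofReal_iff hc).1 h

lemma abs_sub_clamp_le {γ K : ℝ} (h1 : 1 < γ) (hK : 0 < K) (x : ℝ) :
    |x - max (-K) (min x K)| ≤ K ^ (1 - γ) * |x| ^ γ := by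
  rcases le_or_gt |x| K with h | h
  · have h' := abs_le.1 h
    rw [min_eq_left h'.2, max_eq_right h'.1, sub_self, abs_zero]
    positivity
  · have hx : 0 < |x| := hK.trans h
    have e1 : |x - max (-K) (min x K)| ≤ |x| := by
      rcases le_total 0 x with h0 | h0
      · rw [abs_of_nonneg h0] at h
        rw [min_eq_right h.le, max_eq_right (by linarith), abs_of_nonneg (by linarith),
          abs_of_nonneg h0]
        linarith
      · rw [abs_of_nonpos h0] at h
        rw [min_eq_left (by linarith), max_eq_left (by linarith), abs_of_nonpos (by linarith),
          abs_of_nonpos h0]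
        linarith
    have e2 : |x| = |x| ^ (1 - γ) * |x| ^ γ := by
      rw [← Real.rpow_add hx]
      simp
    calc _ ≤ |x| := e1
      _ = |x| ^ (1 - γ) * |x| ^ γ := e2
      _ ≤ _ := mul_le_mul_of_nonneg_right
        (Real.rpow_le_rpow_of_nonpos hK h.le (by linarith)) (by positivity)

/-- Along a weakly convergent family of laws with a bounded moment of order `γ > 1`, a constant mean
passes to the limit. -/
lemma integral_id_eq_of_tendsto {μ : ℝ → ProbabilityMeasure ℝ} {ν : ProbabilityMeasure ℝ}
    (hlim : Tendsto μ atTop (𝓝 ν)) {γ C m : ℝ} (h1 : 1 < γ) (hC : 0 ≤ C)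
    (hmom : ∀ t, 0 ≤ t → absMoment γ (μ t) ≤ ENNReal.ofReal C)
    (hint : ∀ t, 0 ≤ t → Integrable (fun x => x) (μ t : Measure ℝ))
    (hmean : ∀ t, 0 ≤ t → ∫ x, x ∂(μ t : Measure ℝ) = m)
    (hν : Integrable (fun x => x) (ν : Measure ℝ)) : ∫ x, x ∂(ν : Measure ℝ) = m := by
  have hclamp : ∀ K : ℝ, 0 < K → ∀ x : ℝ, ‖max (-K) (min x K)‖ ≤ K := by
    intro K hK x
    rw [Real.norm_eq_abs, abs_le]
    exact ⟨le_max_left _ _, max_le (by linarith) (min_le_right _ _)⟩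
  have hclampint : ∀ K : ℝ, 0 < K → ∀ ρ : Measure ℝ, [IsProbabilityMeasure ρ] →
      Integrable (fun x => max (-K) (min x K)) ρ := fun K hK ρ _ =>
    Integrable.of_bound (C := K) (Measurable.aestronglyMeasurable (by fun_prop))
      (ae_of_all _ (hclamp K hK))
  have hK : ∀ K : ℝ, 0 < K →
      |m - ∫ x, max (-K) (min x K) ∂(ν : Measure ℝ)| ≤ K ^ (1 - γ) * C := by
    intro K hK
    have hcont : Tendsto (fun t => ∫ x, max (-K) (min x K) ∂(μ t : Measure ℝ)) atTop
        (𝓝 (∫ x, max (-K) (min x K) ∂(ν : Measure ℝ))) :=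
      ProbabilityMeasure.tendsto_iff_forall_integral_tendsto.1 hlim
        (BoundedContinuousFunction.ofNormedAddCommGroup (fun x => max (-K) (min x K))
          (by fun_prop) K (hclamp K hK))
    refine le_of_tendsto (hcont.const_sub m).abs ?_
    filter_upwards [eventually_ge_atTop 0] with t ht
    have hm := integrable_abs_rpow_of_absMoment_le hC (hmom t ht)
    rw [← hmean t ht, ← integral_sub (hint t ht) (hclampint K hK _)]
    rw [← Real.norm_eq_abs]
    refine (norm_integral_le_of_norm_le (hm.1.const_mul (K ^ (1 - γ)))
      (ae_of_all _ fun x => abs_sub_clamp_le h1 hK x)).trans ?_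
    rw [integral_const_mul]
    exact mul_le_mul_of_nonneg_left hm.2 (by positivity)
  have hclim : Tendsto (fun K : ℝ => ∫ x, max (-K) (min x K) ∂(ν : Measure ℝ)) atTop
      (𝓝 (∫ x, x ∂(ν : Measure ℝ))) := by
    refine tendsto_integral_filter_of_dominated_convergence (fun x => |x|)
      (Eventually.of_forall fun K => Measurable.aestronglyMeasurable (by fun_prop)) ?_ hν.abs
      (ae_of_all _ fun x => ?_)
    · filter_upwards [eventually_gt_atTop 0] with K hK
      refine ae_of_all _ fun x => ?_
      rw [Real.norm_eq_abs, abs_le]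
      constructor
      · rcases le_total x K with h | h
        · rw [min_eq_left h]
          exact (neg_abs_le x).trans (le_max_right _ _)
        · rw [min_eq_right h]
          exact le_trans (by linarith [abs_nonneg x]) (le_max_right _ _)
      · exact max_le (by linarith [abs_nonneg x]) ((min_le_left _ _).trans (le_abs_self x))
    · refine tendsto_const_nhds.congr' ?_
      filter_upwards [eventually_ge_atTop |x|] with K hK
      have h' := abs_le.1 hK
      rw [min_eq_left h'.2, max_eq_right h'.1]
  have hpow : Tendsto (fun K : ℝ => K ^ (1 - γ) * C) atTop (𝓝 (0 * C)) := by
    have := (tendsto_rpow_neg_atTop (by linarith : 0 < γ - 1)).mul_const C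
    simpa using this
  rw [zero_mul] at hpow
  have hfin : |m - ∫ x, x ∂(ν : Measure ℝ)| ≤ 0 :=
    le_of_tendsto_of_tendsto (hclim.const_sub m).abs hpow
      (by filter_upwards [eventually_gt_atTop 0] with K h using hK K h)
  have := abs_nonpos_iff.1 hfin
  linarith

/-- A family of laws with `γ`-th moment of the order of the `γ`-th power of the mean cannot be tight
while its mean tends to infinity. -/
lemma eq_zero_of_tight_of_absMoment_le {δ : ℝ → Measure ℝ} {g : ℝ → ℝ} {γ C m : ℝ} (h1 : 1 < γ)
    (hC : 0 ≤ C) (hprob : ∀ t, 0 ≤ t → IsProbabilityMeasure (δ t)) (hg : Tendsto g atTop atTop)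
    (hmom : ∀ t, 0 ≤ t → absMoment γ (δ t) ≤ ENNReal.ofReal (C * g t ^ γ))
    (hint : ∀ t, 0 ≤ t → Integrable (fun x => x) (δ t))
    (hmean : ∀ t, 0 ≤ t → ∫ x, x ∂(δ t) = m * g t)
    (htight : ∀ ε : ℝ, 0 < ε → ∃ K : ℝ, 0 < K ∧ ∀ᶠ t in atTop, (δ t).real {x | K < |x|} ≤ ε) :
    m = 0 := by
  have key : ∀ lam : ℝ, 0 < lam → ∀ ε : ℝ, 0 < ε → |m| ≤ lam * ε + lam ^ (1 - γ) * C := by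
    intro lam hlam ε hε
    obtain ⟨K, hK, hKt⟩ := htight ε hε
    have hbound : ∀ᶠ t in atTop, |m| ≤ K / g t + (lam * ε + lam ^ (1 - γ) * C) := by
      filter_upwards [hKt, eventually_ge_atTop 0, hg.eventually_gt_atTop 0] with t h2 ht hgt
      have := hprob t ht
      have hm := integrable_abs_rpow_of_absMoment_le (by positivity) (hmom t ht)
      have hmeas : MeasurableSet {x : ℝ | K < |x|} := measurableSet_lt (by fun_prop) (by fun_prop)
      have hind : Integrable ({x : ℝ | K < |x|}.indicator fun _ => lam * g t) (δ t) :=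
        (integrable_const _).indicator hmeas
      -- small values, values up to `lam * g t`, and large values of `|x|`
      have hpt : ∀ x : ℝ, |x| ≤ (K + {x : ℝ | K < |x|}.indicator (fun _ => lam * g t) x)
          + (lam * g t) ^ (1 - γ) * |x| ^ γ := by
        intro x
        have hp : 0 ≤ (lam * g t) ^ (1 - γ) * |x| ^ γ := by positivity
        rcases le_or_gt |x| K with hx | hx
        · have : x ∉ {x : ℝ | K < |x|} := not_lt.2 hx
          rw [indicator_of_notMem this]
          linarith
        · have : x ∈ {x : ℝ | K < |x|} := hx
          rw [indicator_of_mem this]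
          rcases le_or_gt |x| (lam * g t) with hx2 | hx2
          · linarith
          · have hx0 : 0 < |x| := hK.trans hx
            have hlg : 0 < lam * g t := by positivity
            have e : |x| = |x| ^ (1 - γ) * |x| ^ γ := by
              rw [← Real.rpow_add hx0]
              simp
            have e2 : |x| ^ (1 - γ) * |x| ^ γ ≤ (lam * g t) ^ (1 - γ) * |x| ^ γ :=
              mul_le_mul_of_nonneg_right
                (Real.rpow_le_rpow_of_nonpos hlg hx2.le (by linarith)) (by positivity)
            linarith
      have hKind : Integrable (fun x => K + {x : ℝ | K < |x|}.indicator (fun _ => lam * g t) x)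
          (δ t) := (integrable_const K).add hind
      have hrhs := hKind.add (hm.1.const_mul ((lam * g t) ^ (1 - γ)))
      have hI : ∫ x, |x| ∂(δ t) ≤ (K + (δ t).real {x | K < |x|} * (lam * g t))
          + (lam * g t) ^ (1 - γ) * ∫ x, |x| ^ γ ∂(δ t) := by
        refine (integral_mono (hint t ht).abs hrhs hpt).trans_eq ?_
        simp only [Pi.add_apply]
        rw [integral_add hKind (hm.1.const_mul _),
          integral_add (integrable_const K) hind, integral_const_mul, integral_indicator hmeas]
        simp
      have hlow : |m| * g t ≤ ∫ x, |x| ∂(δ t) := by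
        have := abs_integral_le_integral_abs (f := fun x => x) (μ := δ t)
        rwa [hmean t ht, abs_mul, abs_of_pos hgt] at this
      have hgpow : g t ^ (1 - γ) * g t ^ γ = g t := by
        rw [← Real.rpow_add hgt]
        simp
      have hfin : |m| * g t ≤ (K / g t + (lam * ε + lam ^ (1 - γ) * C)) * g t := by
        calc |m| * g t ≤ (K + (δ t).real {x | K < |x|} * (lam * g t))
              + (lam * g t) ^ (1 - γ) * ∫ x, |x| ^ γ ∂(δ t) := hlow.trans hI
          _ ≤ (K + ε * (lam * g t)) + (lam * g t) ^ (1 - γ) * (C * g t ^ γ) := by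
              gcongr
              exact hm.2
          _ = K + ε * (lam * g t) + lam ^ (1 - γ) * C * (g t ^ (1 - γ) * g t ^ γ) := by
              rw [Real.mul_rpow hlam.le hgt.le]
              ring
          _ = _ := by
              rw [hgpow]
              field_simp
              ring
      exact le_of_mul_le_mul_right hfin hgt
    have hlim : Tendsto (fun t => K / g t + (lam * ε + lam ^ (1 - γ) * C)) atTop
        (𝓝 (0 + (lam * ε + lam ^ (1 - γ) * C))) :=
      (hg.const_div_atTop K).add_const _
    rw [zero_add] at hlim
    exact ge_of_tendsto hlim hbound
  have key2 : ∀ lam : ℝ, 0 < lam → |m| ≤ lam ^ (1 - γ) * C := by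
    intro lam hlam
    have hlim : Tendsto (fun ε : ℝ => lam * ε + lam ^ (1 - γ) * C) (𝓝[>] 0)
        (𝓝 (lam * 0 + lam ^ (1 - γ) * C)) :=
      (((continuous_const.mul continuous_id).add continuous_const).tendsto 0).mono_left
        nhdsWithin_le_nhds
    rw [mul_zero, zero_add] at hlim
    refine ge_of_tendsto hlim ?_
    filter_upwards [self_mem_nhdsWithin] with ε h using key lam hlam ε h
  have hpow : Tendsto (fun K : ℝ => K ^ (1 - γ) * C) atTop (𝓝 (0 * C)) := by
    have := (tendsto_rpow_neg_atTop (by linarith : 0 < γ - 1)).mul_const C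
    simpa using this
  rw [zero_mul] at hpow
  have : |m| ≤ 0 :=
    ge_of_tendsto hpow (by filter_upwards [eventually_gt_atTop 0] with lam h using key2 lam h)
  exact abs_nonpos_iff.1 this

lemma exists_measure_abs_ge_lt (ν : Measure ℝ) [IsProbabilityMeasure ν] {ε : ℝ≥0∞} (hε : 0 < ε) :
    ∃ K : ℝ, 0 < K ∧ ν {x | K ≤ |x|} < ε := by
  have hanti : Antitone fun n : ℕ => {x : ℝ | (n : ℝ) ≤ |x|} := by
    intro m n hmn x hx
    have : (m : ℝ) ≤ n := by exact_mod_cast hmn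
    exact this.trans hx
  have hempty : ⋂ n : ℕ, {x : ℝ | (n : ℝ) ≤ |x|} = ∅ := by
    ext x
    simp only [mem_iInter, mem_ofPred_eq, mem_empty_iff_false, iff_false, not_forall, not_le]
    exact exists_nat_gt |x|
  have h := tendsto_measure_iInter_atTop (μ := ν)
    (fun n : ℕ => (measurableSet_le (by fun_prop) (by fun_prop) :
      MeasurableSet {x : ℝ | (n : ℝ) ≤ |x|}).nullMeasurableSet) hanti ⟨0, measure_ne_top _ _⟩
  rw [hempty, measure_empty] at h
  obtain ⟨n, hn1, hn2⟩ := ((h.eventually_lt_const hε).and (eventually_gt_atTop 0)).exists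
  exact ⟨n, by exact_mod_cast hn2, hn1⟩

lemma exists_eventually_measure_abs_ge_lt {μ : ℝ → ProbabilityMeasure ℝ} {ν : ProbabilityMeasure ℝ}
    (hlim : Tendsto μ atTop (𝓝 ν)) {ε : ℝ≥0∞} (hε : 0 < ε) :
    ∃ K : ℝ, 0 < K ∧ (ν : Measure ℝ) {x | K ≤ |x|} < ε ∧
      ∀ᶠ t in atTop, (μ t : Measure ℝ) {x | K ≤ |x|} < ε := by
  obtain ⟨K, hK, hν⟩ := exists_measure_abs_ge_lt (ν : Measure ℝ) hε
  have hclosed : IsClosed {x : ℝ | K ≤ |x|} := isClosed_le continuous_const continuous_abs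
  refine ⟨K, hK, hν, eventually_lt_of_limsup_lt ?_⟩
  exact (ProbabilityMeasure.limsup_measure_closed_le_of_tendsto hlim hclosed).trans_lt hν

end WeakLimit

/-! ### Couplings and convergence to equilibrium -/

section Coefficients

variable {Ω : Type*} [MeasurableSpace Ω] {P : Measure Ω} [IsProbabilityMeasure P] {L R : Ω → ℝ}

lemma integrable_of_lintegral_rpow_ne_top {γ : ℝ} (h1 : 1 ≤ γ) {f : Ω → ℝ} (hf : Measurable f)
    (hf0 : ∀ᵐ ω ∂P, 0 ≤ f ω) (hfγ : ∫⁻ ω, ENNReal.ofReal (f ω ^ γ) ∂P ≠ ∞) : Integrable f P := by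
  have hγ : Integrable (fun ω => f ω ^ γ) P := by
    refine ⟨Measurable.aestronglyMeasurable (by fun_prop), ?_⟩
    rw [hasFiniteIntegral_iff_ofReal]
    · exact lt_top_iff_ne_top.2 hfγ
    · filter_upwards [hf0] with ω h using Real.rpow_nonneg h _
  refine ((integrable_const (1 : ℝ)).add hγ).mono' hf.aestronglyMeasurable ?_
  filter_upwards [hf0] with ω h
  rw [Real.norm_of_nonneg h]
  simp only [Pi.add_apply]
  rcases le_total (f ω) 1 with h2 | h2
  · linarith [Real.rpow_nonneg h γ]
  · linarith [Real.self_le_rpow_of_one_le h2 h1]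

/-- Convexity of `s ↦ E[L ^ s + R ^ s]`: if this function is `1` at `α > 1` and less than `1` at
`γ > α`, then it is greater than `1` at `1`. -/
lemma one_lt_powerMoment_one (hL0 : ∀ᵐ ω ∂P, 0 ≤ L ω) (hR0 : ∀ᵐ ω ∂P, 0 ≤ R ω)
    (hL : Measurable L) (hR : Measurable R) {α γ : ℝ} (hα : 1 < α) (hαγ : α < γ)
    (hSα : powerMoment P L R α = 1) (hSγ : powerMoment P L R γ < 1)
    (hκ : powerMoment P L R 1 ≠ ∞) : 1 < (powerMoment P L R 1).toReal := by
  have hγ1 : 0 < γ - 1 := by linarith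
  set θ := (γ - α) / (γ - 1) with hθ
  have hθ0 : 0 < θ := div_pos (by linarith) hγ1
  have hθ1 : 0 < 1 - θ := by
    rw [hθ, sub_pos, div_lt_one hγ1]
    linarith
  have hcomb : θ * 1 + γ * (1 - θ) = α := by
    rw [hθ]
    field_simp
    ring
  have hyoung : ∀ x : ℝ, 0 ≤ x → x ^ α ≤ θ * x ^ (1 : ℝ) + (1 - θ) * x ^ γ := by
    intro x hx
    have h := Real.geom_mean_le_arith_mean2_weighted hθ0.le hθ1.le hx (Real.rpow_nonneg hx γ)
      (by ring)
    rw [← Real.rpow_mul hx, ← Real.rpow_add' hx] at h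
    · rw [mul_one] at hcomb
      rw [hcomb] at h
      rwa [Real.rpow_one]
    · rw [mul_one] at hcomb
      rw [hcomb]
      linarith
  have hle : powerMoment P L R α ≤ ENNReal.ofReal θ * powerMoment P L R 1
      + ENNReal.ofReal (1 - θ) * powerMoment P L R γ := by
    rw [powerMoment, powerMoment, powerMoment, ← lintegral_const_mul _ (by fun_prop),
      ← lintegral_const_mul _ (by fun_prop), ← lintegral_add_left (by fun_prop)]
    refine lintegral_mono_ae ?_
    filter_upwards [hL0, hR0] with ω h1 h2
    rw [← ENNReal.ofReal_mul hθ0.le, ← ENNReal.ofReal_mul hθ1.le,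
      ← ENNReal.ofReal_add (by positivity) (by positivity)]
    refine ENNReal.ofReal_le_ofReal ?_
    linarith [hyoung _ h1, hyoung _ h2]
  have hγtop : powerMoment P L R γ ≠ ∞ := (hSγ.trans ENNReal.one_lt_top).ne
  have hγlt := (ENNReal.toReal_lt_toReal hγtop ENNReal.one_ne_top).2 hSγ
  rw [hSα, ← ENNReal.ofReal_toReal hκ, ← ENNReal.ofReal_toReal hγtop, ← ENNReal.ofReal_mul hθ0.le,
    ← ENNReal.ofReal_mul hθ1.le, ← ENNReal.ofReal_add (by positivity) (by positivity),
    ENNReal.one_le_ofReal] at hle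
  rw [ENNReal.toReal_one] at hγlt
  nlinarith

end Coefficients

section Coupling

variable {Ω : Type*} [MeasurableSpace Ω] {P : Measure Ω} [IsProbabilityMeasure P] {L R : Ω → ℝ}

/-- The law of the difference of the two coordinates. -/
noncomputable def diffLaw (π : Measure (ℝ × ℝ)) : Measure ℝ := π.map fun z => z.1 - z.2

lemma measurable_diff : Measurable fun z : ℝ × ℝ => z.1 - z.2 := by fun_prop

lemma isProbabilityMeasure_diffLaw (π : Measure (ℝ × ℝ)) [IsProbabilityMeasure π] :
    IsProbabilityMeasure (diffLaw π) :=
  Measure.isProbabilityMeasure_map measurable_diff.aemeasurable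

lemma absMoment_diffLaw (s : ℝ) (π : Measure (ℝ × ℝ)) :
    absMoment s (diffLaw π) = ∫⁻ z, ENNReal.ofReal (|z.1 - z.2| ^ s) ∂π := by
  rw [absMoment, diffLaw, lintegral_map (measurable_ofReal_abs_rpow s) measurable_diff]

lemma diffLaw_wildSum (hL : Measurable L) (hR : Measurable R) (π : Measure (ℝ × ℝ))
    [IsProbabilityMeasure π] (t : ℝ) :
    diffLaw (wildSum P L R π t) = wildSum P L R (diffLaw π) t :=
  map_wildSum hL hR π (ContinuousLinearMap.fst ℝ ℝ ℝ - ContinuousLinearMap.snd ℝ ℝ ℝ) t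

lemma map_fst_wildSum (hL : Measurable L) (hR : Measurable R) (π : Measure (ℝ × ℝ))
    [IsProbabilityMeasure π] (t : ℝ) :
    (wildSum P L R π t).map Prod.fst = wildSum P L R (π.map Prod.fst) t :=
  map_wildSum hL hR π (ContinuousLinearMap.fst ℝ ℝ ℝ) t

lemma map_snd_wildSum (hL : Measurable L) (hR : Measurable R) (π : Measure (ℝ × ℝ))
    [IsProbabilityMeasure π] (t : ℝ) :
    (wildSum P L R π t).map Prod.snd = wildSum P L R (π.map Prod.snd) t :=
  map_wildSum hL hR π (ContinuousLinearMap.snd ℝ ℝ ℝ) t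

/-- A coupling of the initial law with the stationary law evolves into a coupling of the law at time
`t` with the stationary law. -/
lemma wasserstein_wildSum_le (hL : Measurable L) (hR : Measurable R) {μ ν : Measure ℝ}
    (hν : collide P L R ν ν = ν) {π : Measure (ℝ × ℝ)} [IsProbabilityMeasure π]
    (hfst : π.map Prod.fst = μ) (hsnd : π.map Prod.snd = ν) (γ : ℝ) {t : ℝ} (ht : 0 ≤ t) :
    wasserstein γ (wildSum P L R μ t) ν ≤
      absMoment γ (wildSum P L R (diffLaw π) t) ^ (1 / max γ 1) := by
  rw [← diffLaw_wildSum hL hR, absMoment_diffLaw]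
  refine iInf₂_le (wildSum P L R π t) ⟨?_, ?_⟩
  · rw [map_fst_wildSum hL hR, hfst]
  · rw [map_snd_wildSum hL hR, hsnd, wildSum_of_collide_eq hν ht]

lemma absMoment_one_ne_top {γ : ℝ} (h1 : 1 ≤ γ) {μ : Measure ℝ} [IsProbabilityMeasure μ]
    (h : absMoment γ μ ≠ ∞) : absMoment 1 μ ≠ ∞ := by
  have := integrable_of_lintegral_rpow_ne_top (P := μ) h1 (f := fun x => |x|) (by fun_prop)
    (ae_of_all _ fun x => abs_nonneg x) h
  rw [← integrable_id_iff_absMoment]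
  exact (integrable_norm_iff (by fun_prop)).1 this

lemma measure_diffLaw_le {π : Measure (ℝ × ℝ)} (K : ℝ) :
    diffLaw π {x | 2 * K < |x|} ≤ π.map Prod.fst {x | K ≤ |x|} + π.map Prod.snd {x | K ≤ |x|} := by
  have hm : MeasurableSet {x : ℝ | K ≤ |x|} := measurableSet_le (by fun_prop) (by fun_prop)
  rw [diffLaw, Measure.map_apply measurable_diff (measurableSet_lt (by fun_prop) (by fun_prop)),
    Measure.map_apply measurable_fst hm, Measure.map_apply measurable_snd hm]
  refine (measure_mono fun z hz => ?_).trans (measure_union_le _ _)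
  have hz : 2 * K < |z.1 - z.2| := hz
  by_contra hcon
  simp only [mem_union, mem_preimage, mem_ofPred_eq, not_or, not_le] at hcon
  have := abs_sub z.1 z.2
  linarith [hcon.1, hcon.2]

/-- If the solution converges weakly to `ν`, then the difference in any coupling of finite cost of
the initial law `μ₀` with `ν` has mean zero. For `α = 1` the mean is conserved and the `γ`-th moment
stays bounded, so that `ν` has the mean of `μ₀`. For `α > 1` the mean of the difference in the
evolved coupling tends to infinity unless it vanishes, and its `γ`-th moment grows no faster than
the `γ`-th power of the mean. Hence part of the mass would escape to infinity, against the tightness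
of the solution. -/
theorem integral_id_diffLaw_eq_zero (hL : Measurable L) (hR : Measurable R)
    (hL0 : ∀ᵐ ω ∂P, 0 ≤ L ω) (hR0 : ∀ᵐ ω ∂P, 0 ≤ R ω) {α γ : ℝ} (hα : 1 ≤ α) (hαγ : α < γ)
    (h2 : γ ≤ 2) (hSα : powerMoment P L R α = 1) (hSγ : powerMoment P L R γ < 1)
    {μ₀ : Measure ℝ} [IsProbabilityMeasure μ₀] {μ : ℝ → ProbabilityMeasure ℝ}
    {ν : ProbabilityMeasure ℝ} (hμ : ∀ t, 0 ≤ t → (μ t : Measure ℝ) = wildSum P L R μ₀ t)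
    (hlim : Tendsto μ atTop (𝓝 ν)) (hν : collide P L R (ν : Measure ℝ) ν = ν)
    (hmom : α = 1 → absMoment γ μ₀ ≠ ∞)
    {π : Measure (ℝ × ℝ)} [IsProbabilityMeasure π] (hfst : π.map Prod.fst = μ₀)
    (hsnd : π.map Prod.snd = ν) (hcost : absMoment γ (diffLaw π) ≠ ∞) :
    Integrable (fun x => x) (diffLaw π) ∧ ∫ x, x ∂(diffLaw π) = 0 := by
  have h1 : 1 < γ := hα.trans_lt hαγ
  have hδprob := isProbabilityMeasure_diffLaw π
  have hδ1 := absMoment_one_ne_top h1.le hcost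
  have hδ := integrable_id_iff_absMoment.2 hδ1
  refine ⟨hδ, ?_⟩
  have hγtop : powerMoment P L R γ ≠ ∞ := (hSγ.trans ENNReal.one_lt_top).ne
  have hLRtop := hγtop
  rw [powerMoment_eq_add hL hL0 hR0, ENNReal.add_ne_top] at hLRtop
  have hLi := integrable_of_lintegral_rpow_ne_top h1.le hL hL0 hLRtop.1
  have hRi := integrable_of_lintegral_rpow_ne_top h1.le hR hR0 hLRtop.2
  have hκ := (toReal_powerMoment_one hL0 hR0 hLi hRi).1
  rcases hα.eq_or_lt with rfl | hα1
  · have hκ1 : (powerMoment P L R 1).toReal = 1 := by rw [hSα, ENNReal.toReal_one]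
    have hμγ := hmom rfl
    have hμ1 := absMoment_one_ne_top h1.le hμγ
    have hμint := integrable_id_iff_absMoment.2 hμ1
    obtain ⟨C, hC, hCt⟩ := absMoment_wildSum_le_meanGrowth hL hR hL0 hR0 h1.le h2 hκ hκ1.ge hSγ
      hμ1 hμγ
    have hπfst : Integrable (fun z : ℝ × ℝ => z.1) π := by
      have : Integrable (fun x => x) (π.map Prod.fst) := by rwa [hfst]
      exact this.comp_measurable measurable_fst
    have hπdiff : Integrable (fun z : ℝ × ℝ => z.1 - z.2) π :=
      Integrable.comp_measurable (g := fun x => x) hδ measurable_diff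
    have hπsnd : Integrable (fun z : ℝ × ℝ => z.2) π :=
      (hπfst.sub hπdiff).congr (ae_of_all _ fun z => by simp)
    have hνint : Integrable (fun x => x) (ν : Measure ℝ) := by
      rw [← hsnd, integrable_map_measure (by fun_prop) measurable_snd.aemeasurable]
      exact hπsnd
    have hlimit := integral_id_eq_of_tendsto hlim h1 hC (m := ∫ x, x ∂μ₀) (fun t ht => ?_)
      (fun t ht => ?_) (fun t ht => ?_) hνint
    · rw [diffLaw, integral_map measurable_diff.aemeasurable (by fun_prop),
        integral_sub hπfst hπsnd, sub_eq_zero]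
      rw [← hsnd, ← hfst, integral_map measurable_snd.aemeasurable (by fun_prop),
        integral_map measurable_fst.aemeasurable (by fun_prop)] at hlimit
      exact hlimit.symm
    · have := hCt t ht
      rwa [hκ1, meanGrowth_one (one_sub_exp_neg_mem ht), Real.one_rpow, mul_one, ← hμ t ht] at this
    · rw [hμ t ht]
      exact (integral_id_wildSum hL hR hL0 hR0 hLi hRi hκ1.ge hμint ht).1
    · rw [hμ t ht, (integral_id_wildSum hL hR hL0 hR0 hLi hRi hκ1.ge hμint ht).2, hκ1,
        meanGrowth_one (one_sub_exp_neg_mem ht), mul_one]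
  · have hκ1 := one_lt_powerMoment_one hL0 hR0 hL hR hα1 hαγ hSα hSγ hκ
    obtain ⟨C, hC, hCt⟩ := absMoment_wildSum_le_meanGrowth hL hR hL0 hR0 h1.le h2 hκ hκ1.le hSγ
      hδ1 hcost
    refine eq_zero_of_tight_of_absMoment_le (δ := wildSum P L R (diffLaw π)) h1 hC
      (fun t ht => isProbabilityMeasure_wildSum hL hR _ ht) (tendsto_meanGrowth hκ1) hCt
      (fun t ht => (integral_id_wildSum hL hR hL0 hR0 hLi hRi hκ1.le hδ ht).1)
      (fun t ht => (integral_id_wildSum hL hR hL0 hR0 hLi hRi hκ1.le hδ ht).2) fun ε hε => ?_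
    have hε2 : 0 < ENNReal.ofReal (ε / 2) := ENNReal.ofReal_pos.2 (half_pos hε)
    obtain ⟨K, hK, hνK, hμK⟩ := exists_eventually_measure_abs_ge_lt hlim hε2
    refine ⟨2 * K, by positivity, ?_⟩
    filter_upwards [hμK, eventually_ge_atTop 0] with t h3 ht
    have hle := measure_diffLaw_le (π := wildSum P L R π t) K
    rw [diffLaw_wildSum hL hR, map_fst_wildSum hL hR, map_snd_wildSum hL hR, hfst, hsnd,
      wildSum_of_collide_eq hν ht, ← hμ t ht] at hle
    refine ENNReal.toReal_le_of_le_ofReal hε.le (hle.trans ?_)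
    calc _ ≤ ENNReal.ofReal (ε / 2) + ENNReal.ofReal (ε / 2) := add_le_add h3.le hνK.le
      _ = ENNReal.ofReal ε := by
        rw [← ENNReal.ofReal_add (by positivity) (by positivity), add_halves]

end Coupling

lemma powerMoment_lt_one_of_S_neg {Ω : Type*} [MeasurableSpace Ω] {P : Measure Ω} {L R : Ω → ℝ}
    {γ : ℝ} (h : S P L R γ < 0) : powerMoment P L R γ < 1 ∧
      |(S P L R γ).toReal| = 1 - (powerMoment P L R γ).toReal := by
  have htop : powerMoment P L R γ ≠ ∞ := by
    intro htop
    rw [S, htop, EReal.coe_ennreal_top, ← EReal.coe_one, EReal.top_sub_coe] at h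
    exact not_top_lt h
  have hS : S P L R γ = (((powerMoment P L R γ).toReal - 1 : ℝ) : EReal) := by
    rw [S]
    conv_lhs => rw [← ENNReal.ofReal_toReal htop]
    rw [EReal.coe_ennreal_ofReal, max_eq_left ENNReal.toReal_nonneg, EReal.coe_sub, EReal.coe_one]
  have hlt : (powerMoment P L R γ).toReal - 1 < 0 := by
    rw [hS] at h
    exact_mod_cast h
  constructor
  · rw [← ENNReal.ofReal_toReal htop, ← ENNReal.ofReal_one]
    exact (ENNReal.ofReal_lt_ofReal_iff one_pos).2 (by linarith)
  · rw [hS, EReal.toReal_coe, abs_of_neg hlt]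
    ring

end KineticCLT

theorem proposition3p6
    {Ω Ω' : Type*} [MeasurableSpace Ω] [MeasurableSpace Ω']
    (P : Measure Ω) [IsProbabilityMeasure P] (P' : Measure Ω') [IsProbabilityMeasure P']
    (L R X₀ : Ω → ℝ) (V : ℝ → Ω → ℝ) (Vinf : Ω' → ℝ)
    (hL : Measurable L) (hR : Measurable R) (hX₀ : Measurable X₀)
    (hV : ∀ t, Measurable (V t)) (hVinf : Measurable Vinf)
    (hL0 : ∀ᵐ ω ∂P, 0 ≤ L ω) (hR0 : ∀ᵐ ω ∂P, 0 ≤ R ω)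
    -- the characteristic functions of `V t` solve the initial value problem started at `X₀`
    (hsol : KineticCLT.SolvesBoltzmann P L R (charFun (P.map X₀)) (fun t => charFun (P.map (V t))))
    -- `Vinf` is the limit in distribution of `V t` as `t → ∞`
    (hlim : TendstoInDistribution V atTop Vinf (fun _ => P) P')
    (α γ : ℝ) (hα : 0 < α)
    (hαγ : (1 ≤ α ∧ α < γ ∧ γ ≤ 2) ∨ (α < γ ∧ γ ≤ 1))
    (hSα : KineticCLT.powerMoment P L R α = 1)
    (hSγ : KineticCLT.S P L R γ < 0)
    (htail : α ≠ 1 → KineticCLT.StableTails α (P.map X₀))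
    (hmom : α = 1 → Integrable (fun ω => |X₀ ω| ^ γ) P) :
    ∀ t : ℝ, 0 ≤ t →
      KineticCLT.wasserstein γ (P.map (V t)) (P'.map Vinf) ≤
        ENNReal.ofReal (KineticCLT.constA γ)
          * KineticCLT.wasserstein γ (P.map X₀) (P'.map Vinf)
          * ENNReal.ofReal
              (Real.exp (-(KineticCLT.constB γ * t * |(KineticCLT.S P L R γ).toReal|))) := by
  intro t ht
  obtain ⟨hκ, hSabs⟩ := KineticCLT.powerMoment_lt_one_of_S_neg hSγ
  have hκtop : KineticCLT.powerMoment P L R γ ≠ ∞ := (hκ.trans ENNReal.one_lt_top).ne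
  have hγ0 : 0 < γ := by rcases hαγ with h | h <;> linarith [h.1, h.2]
  have hX₀p : IsProbabilityMeasure (P.map X₀) := Measure.isProbabilityMeasure_map hX₀.aemeasurable
  have hVp : ∀ t, IsProbabilityMeasure (P.map (V t)) := fun t =>
    Measure.isProbabilityMeasure_map (hV t).aemeasurable
  have hνp : IsProbabilityMeasure (P'.map Vinf) :=
    Measure.isProbabilityMeasure_map hVinf.aemeasurable
  have hconv := hlim.tendsto
  have hlaw : ∀ t, 0 ≤ t → P.map (V t) = KineticCLT.wildSum P L R (P.map X₀) t := fun t ht =>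
    KineticCLT.eq_wildSum_of_solvesBoltzmann hL hR hsol ht
  have hstat : KineticCLT.collide P L R (P'.map Vinf) (P'.map Vinf) = P'.map Vinf :=
    KineticCLT.collide_limit_eq hL hR hsol fun ξ => tendsto_of_seq_tendsto fun u hu =>
      ProbabilityMeasure.tendsto_iff_tendsto_charFun.1 (hconv.comp hu) ξ
  set A := ENNReal.ofReal (KineticCLT.constA γ) with hA
  set e := ENNReal.ofReal
    (Real.exp (-(KineticCLT.constB γ * t * |(KineticCLT.S P L R γ).toReal|))) with he
  have hApos : 0 < KineticCLT.constA γ := by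
    rw [KineticCLT.constA]
    split_ifs <;> positivity
  have hA0 : A ≠ 0 := (ENNReal.ofReal_pos.2 hApos).ne'
  have he0 : e ≠ 0 := (ENNReal.ofReal_pos.2 (Real.exp_pos _)).ne'
  have hAe0 : A * e ≠ 0 := mul_ne_zero hA0 he0
  have hAetop : A * e ≠ ∞ := ENNReal.mul_ne_top ENNReal.ofReal_ne_top ENNReal.ofReal_ne_top
  rw [mul_right_comm, ← ENNReal.div_le_iff' hAe0 hAetop]
  refine le_iInf₂ fun π hπ => ?_
  rw [ENNReal.div_le_iff' hAe0 hAetop]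
  have hπp : IsProbabilityMeasure π := by
    constructor
    have h := measure_univ (μ := P.map X₀)
    rwa [← hπ.1, Measure.map_apply measurable_fst MeasurableSet.univ, preimage_univ] at h
  rw [← KineticCLT.absMoment_diffLaw]
  have hδp := KineticCLT.isProbabilityMeasure_diffLaw π
  have hexp : 0 < 1 / max γ 1 := by positivity
  by_cases hcost : KineticCLT.absMoment γ (KineticCLT.diffLaw π) = ∞
  · rw [hcost, ENNReal.top_rpow_of_pos hexp, ENNReal.mul_top hAe0]
    exact le_top
  have hW := KineticCLT.wasserstein_wildSum_le (P := P) hL hR hstat hπ.1 hπ.2 γ ht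
  rw [hlaw t ht]
  refine hW.trans ?_
  rcases le_or_gt γ 1 with hγ1 | hγ1
  · have hprob := fun n => KineticCLT.isProbabilityMeasure_wild (P := P) hL hR
      (KineticCLT.diffLaw π) n
    have h := KineticCLT.absMoment_wildSum_le (P := P) hL hL0 hR0 hκtop hcost
      (fun i j => KineticCLT.absMoment_collide_le_of_le_one hL hR hL0 hR0 hγ0 hγ1 _ _) ht
    rw [max_eq_right hγ1, div_one, ENNReal.rpow_one, ENNReal.rpow_one, hA, he, KineticCLT.constA,
      KineticCLT.constB, if_pos hγ1, if_pos hγ1, ENNReal.ofReal_one, one_mul, one_mul, hSabs,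
      mul_comm]
    exact h
  · obtain ⟨hα1, hαlt, hγ2⟩ : 1 ≤ α ∧ α < γ ∧ γ ≤ 2 := by
      rcases hαγ with h | h
      · exact h
      · exact absurd h.2 (not_le.2 hγ1)
    have hLRtop := hκtop
    rw [KineticCLT.powerMoment_eq_add hL hL0 hR0, ENNReal.add_ne_top] at hLRtop
    have hLi := KineticCLT.integrable_of_lintegral_rpow_ne_top hγ1.le hL hL0 hLRtop.1
    have hRi := KineticCLT.integrable_of_lintegral_rpow_ne_top hγ1.le hR hR0 hLRtop.2
    have hmom' : α = 1 → KineticCLT.absMoment γ (P.map X₀) ≠ ∞ := by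
      intro h
      rw [KineticCLT.absMoment, lintegral_map (KineticCLT.measurable_ofReal_abs_rpow γ) hX₀]
      exact (hmom h).lintegral_lt_top.ne
    obtain ⟨hint, hmean⟩ := KineticCLT.integral_id_diffLaw_eq_zero
      (μ := fun t => ⟨P.map (V t), hVp t⟩) hL hR hL0 hR0 hα1 hαlt hγ2 hSα hκ hlaw
      hconv hstat hmom' hπ.1 hπ.2 hcost
    have h := KineticCLT.absMoment_wildSum_le_of_centered hL hR hL0 hR0 hLi hRi hγ1.le hγ2 hκtop
      hint hmean hcost ht
    rw [max_eq_left hγ1.le]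
    refine (ENNReal.rpow_le_rpow h (by positivity)).trans_eq ?_
    have hinv : 0 ≤ 1 / γ := by positivity
    rw [ENNReal.mul_rpow_of_nonneg _ _ hinv, ENNReal.mul_rpow_of_nonneg _ _ hinv, hA, he,
      KineticCLT.constA, KineticCLT.constB, if_neg (not_le.2 hγ1), if_neg (not_le.2 hγ1),
      ENNReal.ofReal_rpow_of_pos (Real.exp_pos _), ← Real.exp_mul, hSabs,
      ← ENNReal.ofReal_rpow_of_pos two_pos, ENNReal.ofReal_ofNat, mul_right_comm]
    congr 4
    ring
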